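/- Let $V:\mathbb{R}\to\mathbb{R}$ belong to $BC^2(\mathbb{R})$ (that is, $V$, $V'$, $V''$ exist and are continuous and bounded), with $V(x)>0$ and $|V'(x)|\le\alpha V(x)$ for all $x\in\mathbb{R}$, where $\alpha>0$ is a constant, and suppose that $\alpha^2\|V\|_\infty<1$. Let $u_0,u_1\in H^3(\mathbb{R})$ be real-valued with $$\frac{u_0+u_1-u_1''}{\sqrt{V}}\in L^2(\mathbb{R}).$$ Then the problem $$u_{tt}-u_{ttxx}-u_{xx}+V(x)u+u_t=0\quad (t>0,\ x\in\mathbb{R}),\qquad u(0,\cdot)=u_0,\quad u_t(0,\cdot)=u_1,$$ has a unique strong solution $u\in C^2([0,\infty);H^2(\mathbb{R}))$, and, with $\|\cdot\|$ the norm of $L^2(\mathbb{R})$ and $$E_u(t)=\tfrac12\Big(\|u_t(t,\cdot)\|^2+\|u_{tx}(t,\cdot)\|^2+\|u_x(t,\cdot)\|^2+\|\sqrt{V}\,u(t,\cdot)\|^2\Big),\qquad I=\|u_0\|_{H^3}^2+\|u_1\|_{H^3}^2+\Big\|\frac{u_0+u_1-u_1''}{\sqrt{V}}\Big\|^2,$$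 it satisfies, for all $t\ge0$, $$E_u(t)\le C\,I\,(1+t)^{-2},\qquad \|u(t,\cdot)\|^2\le C\,I\,(1+t)^{-1},$$ where the constant $C>0$ depends only on $\alpha$, $\|V\|_\infty$, $\|V'\|_\infty$ and $\|V''\|_\infty$. -/

import Mathlib

open MeasureTheory Set
open scoped ContDiff ENNReal

noncomputable section

namespace RotInertiaWave

/-- The real Hilbert space `L²(ℝ)`. -/
abbrev L2 : Type := Lp ℝ 2 (volume : Measure ℝ)

/-- `g` is the weak derivative of `f` (both in `L²(ℝ)`):
`∫ f φ' = - ∫ g φ` for every real test function `φ ∈ C_c^∞(ℝ)`. -/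
def IsWeakDeriv (f g : L2) : Prop :=
  ∀ φ : ℝ → ℝ, ContDiff ℝ ∞ φ → HasCompactSupport φ →
    ∫ x, f x * deriv φ x = - ∫ x, g x * φ x

theorem integrable_mul_test (f : L2) {φ : ℝ → ℝ} (hφ : Continuous φ)
    (hc : HasCompactSupport φ) : Integrable (fun x => f x * φ x) :=
  (Lp.memLp f).integrable_mul (hφ.memLp_of_hasCompactSupport (p := 2) hc)

theorem IsWeakDeriv.zero : IsWeakDeriv 0 0 := by
  intro φ _ _
  have h : ∀ ψ : ℝ → ℝ, ∫ x, (0 : L2) x * ψ x = 0 := fun ψ => by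
    refine integral_eq_zero_of_ae ?_
    filter_upwards [Lp.coeFn_zero ℝ 2 (volume : Measure ℝ)] with x hx
    rw [hx]; simp
  rw [h, h, neg_zero]

theorem integral_add_mul_test (f g : L2) {φ : ℝ → ℝ} (hφ : Continuous φ)
    (hc : HasCompactSupport φ) :
    ∫ x, (f + g : L2) x * φ x = (∫ x, f x * φ x) + ∫ x, g x * φ x := by
  rw [← integral_add (integrable_mul_test f hφ hc) (integrable_mul_test g hφ hc)]
  refine integral_congr_ae ?_
  filter_upwards [Lp.coeFn_add f g] with x hx
  rw [hx, Pi.add_apply, add_mul]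

theorem integral_smul_mul_test (c : ℝ) (f : L2) (φ : ℝ → ℝ) :
    ∫ x, (c • f : L2) x * φ x = c * ∫ x, f x * φ x := by
  rw [← integral_const_mul]
  refine integral_congr_ae ?_
  filter_upwards [Lp.coeFn_smul c f] with x hx
  rw [hx, Pi.smul_apply, smul_eq_mul, mul_assoc]

theorem IsWeakDeriv.add {f g f' g' : L2} (hf : IsWeakDeriv f f') (hg : IsWeakDeriv g g') :
    IsWeakDeriv (f + g) (f' + g') := by
  intro φ h1 h2
  rw [integral_add_mul_test f g (h1.continuous_deriv (by simp)) h2.deriv,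
    integral_add_mul_test f' g' h1.continuous h2, hf φ h1 h2, hg φ h1 h2]
  ring

theorem IsWeakDeriv.smul (c : ℝ) {f f' : L2} (hf : IsWeakDeriv f f') :
    IsWeakDeriv (c • f) (c • f') := by
  intro φ h1 h2
  rw [integral_smul_mul_test, integral_smul_mul_test, hf φ h1 h2]
  ring

/-- The real Sobolev space `H^k(ℝ)`. An element is the tuple `(f, f', …, f^(k))` of an
`L²` function and its weak derivatives up to order `k`, all in `L²`; as weak derivatives are
unique, this is the usual space. The tuples sit in the `ℓ²`-product of `k + 1` copies of
`L²(ℝ)`, so the norm is the usual one, `‖f‖_{H^k}² = ∑_{j ≤ k} ‖f^(j)‖²`. -/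
def H (k : ℕ) : Submodule ℝ (PiLp 2 (fun _ : Fin (k + 1) => L2)) where
  carrier := {F | ∀ i : Fin k, IsWeakDeriv (F i.castSucc) (F i.succ)}
  zero_mem' := fun _ => IsWeakDeriv.zero
  add_mem' := fun ha hb i => (ha i).add (hb i)
  smul_mem' := fun c _ ha i => (ha i).smul c

/-- `D j f` is the weak derivative of order `j` of `f ∈ H^k(ℝ)`; `D 0 f` is `f` itself,
as an element of `L²(ℝ)`. -/
def D {k : ℕ} (j : Fin (k + 1)) (f : H k) : L2 :=
  (f : PiLp 2 (fun _ : Fin (k + 1) => L2)) j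

/-- The `L²` norm of a function `g : ℝ → ℝ` (used only when `g ∈ L²(ℝ)`). -/
def l2Norm (g : ℝ → ℝ) : ℝ := (eLpNorm g 2 (volume : Measure ℝ)).toReal

/-- The supremum norm of a bounded function. -/
def supNorm (g : ℝ → ℝ) : ℝ := ⨆ x : ℝ, |g x|

/-- `g` is continuous and bounded on `ℝ`. -/
def IsBC (g : ℝ → ℝ) : Prop := Continuous g ∧ ∃ M : ℝ, ∀ x, |g x| ≤ M

/-- `V ∈ BC²(ℝ)`: `V` is twice differentiable and `V`, `V'`, `V''` are continuous and bounded. -/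
def IsBC2 (V : ℝ → ℝ) : Prop :=
  Differentiable ℝ V ∧ Differentiable ℝ (deriv V) ∧
    IsBC V ∧ IsBC (deriv V) ∧ IsBC (deriv (deriv V))

/-- The time derivative on `[0, ∞)` (one-sided at `0`), in the norm of `H^k(ℝ)`. -/
def timeDeriv {k : ℕ} (u : ℝ → H k) : ℝ → H k := derivWithin u (Ici 0)

/-- `u` is a strong solution of `u_tt - u_ttxx - u_xx + V u + u_t = 0`, `u(0) = f₀`,
`u_t(0) = f₁`: it is in `C²([0, ∞); H²(ℝ))` (values at negative times are irrelevant), the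
equation holds almost everywhere in `x` for every `t > 0`, and the initial values are taken. -/
structure IsStrongSolution (V : ℝ → ℝ) (f₀ f₁ : L2) (u : ℝ → H 2) : Prop where
  contDiffOn : ContDiffOn ℝ 2 u (Ici 0)
  equation : ∀ t : ℝ, 0 < t → ∀ᵐ x : ℝ,
    D 0 (timeDeriv (timeDeriv u) t) x - D 2 (timeDeriv (timeDeriv u) t) x
      - D 2 (u t) x + V x * D 0 (u t) x + D 0 (timeDeriv u t) x = 0
  initial : D 0 (u 0) = f₀
  initial_deriv : D 0 (timeDeriv u 0) = f₁

/-- The total energy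
`E_u(t) = ½ (‖u_t‖² + ‖∂ₓ u_t‖² + ‖∂ₓ u‖² + ‖√V u‖²)`, all norms in `L²(ℝ)`. -/
def energy (V : ℝ → ℝ) (u : ℝ → H 2) (t : ℝ) : ℝ :=
  (1 / 2) * (‖D 0 (timeDeriv u t)‖ ^ 2 + ‖D 1 (timeDeriv u t)‖ ^ 2 + ‖D 1 (u t)‖ ^ 2
    + l2Norm (fun x => √(V x) * D 0 (u t) x) ^ 2)

/-- The function `(u₀ + u₁ - u₁'') / √V`. -/
def weightedData (V : ℝ → ℝ) (u₀ u₁ : H 3) (x : ℝ) : ℝ :=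
  (D 0 u₀ x + D 0 u₁ x - D 2 u₁ x) / √(V x)

/-- `‖u₀‖²_{H³} + ‖u₁‖²_{H³} + ‖(u₀ + u₁ - u₁'') / √V‖²`. -/
def dataSize (V : ℝ → ℝ) (u₀ u₁ : H 3) : ℝ :=
  ‖u₀‖ ^ 2 + ‖u₁‖ ^ 2 + l2Norm (weightedData V u₀ u₁) ^ 2

end RotInertiaWave

end

open RotInertiaWave

noncomputable section

namespace RotInertiaWave

open Filter Topology

/-! The equation reads (1 - ∂ₓ²) u_tt = u'' - V u - u_t. As (1 - ∂ₓ²)⁻¹ gains two derivatives, this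
is a linear ODE with bounded generator on H³ × H³, solved by an operator exponential
(`exists_isFlow`). Uniqueness among H² solutions follows from monotonicity of the energy of a
difference (`IsStrongSolution.eqOn`).

For the decay, damping only gives E₀' = -‖u_t‖², whereas E₀ also contains ‖u_tx‖². The missing
control comes from the energies E₁, E₂ of u_x, u_xx, which is why H³ data are needed, and from
functionals G₀, G₁ obtained by testing the equation with u and -u_xx. The commutator V' u in E₁' is
harmless because |V'| ≤ αV gives |V'|² ≤ δV with δ = α²‖V‖_∞; then Z = 5E₀ + (1+δ)G₀ + 4E₁ satisfies
Z' ≤ -2(1-δ)E₀, and δ < 1 is what makes this useful.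

Time weights also require integrability of ‖u‖² in time. The antiderivative w(t) = ∫₀ᵗ u solves the
same equation with the constant source u₀ + u₁ - u₁'' = √V κ (`IsFlow.integrated_equation`). Its
energy minus ⟪√V κ, w⟫ has derivative -‖u‖² and is at least -½‖κ‖². A single decreasing functional
with weights (1+t)², 1+t and 1 combines all this (`decay_of_energy_inequalities`). -/

/-! ### Test functions and uniqueness of weak derivatives -/

theorem inner_eq_integral_of_ae_eq (f : L2) {g : L2} {φ : ℝ → ℝ} (h : g =ᵐ[volume] φ) :
    inner ℝ f g = ∫ x, f x * φ x := by
  rw [L2.inner_def]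
  refine integral_congr_ae ?_
  filter_upwards [h] with x hx
  simp [hx, mul_comm]

theorem inner_toLp (f : L2) {φ : ℝ → ℝ} (h : MemLp φ 2 volume) :
    inner ℝ f (h.toLp φ) = ∫ x, f x * φ x :=
  inner_eq_integral_of_ae_eq f h.coeFn_toLp

/-- The subspace of `L²(ℝ)` of the classes of test functions. -/
def testSubmodule : Submodule ℝ L2 where
  carrier := {g | ∃ φ : ℝ → ℝ, ContDiff ℝ ∞ φ ∧ HasCompactSupport φ ∧ g =ᵐ[volume] φ}
  zero_mem' := ⟨fun _ => 0, contDiff_const, HasCompactSupport.zero,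
    Lp.coeFn_zero ℝ 2 (volume : Measure ℝ)⟩
  add_mem' := by
    rintro a b ⟨φ, h1, h2, h3⟩ ⟨ψ, k1, k2, k3⟩
    exact ⟨φ + ψ, h1.add k1, h2.add k2, (Lp.coeFn_add a b).trans (h3.add k3)⟩
  smul_mem' := by
    rintro c a ⟨φ, h1, h2, h3⟩
    refine ⟨c • φ, h1.const_smul c, h2.smul_left (f := fun _ => c), ?_⟩
    filter_upwards [Lp.coeFn_smul c a, h3] with x hx hx'
    rw [hx, Pi.smul_apply, hx', Pi.smul_apply]

theorem eq_zero_of_forall_test {f : L2} (h : ∀ φ : ℝ → ℝ, ContDiff ℝ ∞ φ → HasCompactSupport φ →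
    ∫ x, f x * φ x = 0) : f = 0 := by
  refine (Lp.eq_zero_iff_ae_eq_zero).2 ?_
  refine ae_eq_zero_of_integral_contDiff_smul_eq_zero
    ((Lp.memLp f).locallyIntegrable (by norm_num)) fun φ h1 h2 => ?_
  simpa [mul_comm] using h φ h1 h2

theorem dense_testSubmodule : Dense (testSubmodule : Set L2) := by
  rw [Submodule.dense_iff_topologicalClosure_eq_top, Submodule.topologicalClosure_eq_top_iff,
    Submodule.eq_bot_iff]
  intro f hf
  refine eq_zero_of_forall_test fun φ h1 h2 => ?_
  have hm := h1.continuous.memLp_of_hasCompactSupport (μ := volume) (p := 2) h2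
  rw [← inner_toLp f hm, real_inner_comm]
  exact (Submodule.mem_orthogonal _ _).1 hf _ ⟨φ, h1, h2, hm.coeFn_toLp⟩

theorem IsWeakDeriv.unique {f g g' : L2} (h : IsWeakDeriv f g) (h' : IsWeakDeriv f g') :
    g = g' := by
  have h0 := h.add (h'.smul (-1))
  rw [← sub_eq_zero]
  refine eq_zero_of_forall_test fun φ h1 h2 => ?_
  have e1 := h φ h1 h2
  have e2 := h' φ h1 h2
  have := integral_add_mul_test g ((-1 : ℝ) • g') h1.continuous h2
  rw [integral_smul_mul_test] at this
  rw [sub_eq_add_neg, ← neg_one_smul ℝ g', this]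
  linarith

/-! ### Translations, difference quotients and integration by parts -/

/-- Translation `f ↦ f (· + h)` on `L²(ℝ)`. -/
def translation (h : ℝ) : L2 →ₗᵢ[ℝ] L2 :=
  Lp.compMeasurePreservingₗᵢ ℝ (fun x => x + h) (measurePreserving_add_right volume h)

theorem coeFn_translation (h : ℝ) (f : L2) :
    translation h f =ᵐ[volume] fun x => f (x + h) :=
  Lp.coeFn_compMeasurePreserving f (measurePreserving_add_right volume h)

theorem inner_translation_left (h : ℝ) (f g : L2) :
    inner ℝ (translation h f) g = inner ℝ f (translation (-h) g) := by
  rw [inner_eq_integral_of_ae_eq f (coeFn_translation (-h) g), real_inner_comm,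
    inner_eq_integral_of_ae_eq g (coeFn_translation h f),
    ← integral_add_right_eq_self (fun x => f x * g (x + -h)) h]
  simp [mul_comm]

theorem inner_translation_test (h : ℝ) (f : L2) {g : L2} {φ : ℝ → ℝ} (hg : g =ᵐ[volume] φ) :
    inner ℝ (translation h f) g = ∫ x, f x * φ (x - h) := by
  rw [inner_translation_left]
  refine inner_eq_integral_of_ae_eq f ((coeFn_translation (-h) g).trans ?_)
  exact (measurePreserving_add_right volume (-h)).quasiMeasurePreserving.ae_eq_comp hg

theorem hasCompactSupport_comp_sub {φ : ℝ → ℝ} (hc : HasCompactSupport φ) (h : ℝ) :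
    HasCompactSupport fun x => φ (x - h) :=
  hc.comp_homeomorph (Homeomorph.subRight h)

/-- Against a test function φ the pairing is the convolution of f with φ(-·), so the derivative in h
falls on φ; the definition of weak derivative moves it back to f. -/
theorem IsWeakDeriv.hasDerivAt_inner_translation {f f' : L2} (hf : IsWeakDeriv f f') {g : L2}
    (hg : g ∈ testSubmodule) (h : ℝ) :
    HasDerivAt (fun h => inner ℝ (translation h f) g) (inner ℝ (translation h f') g) h := by
  obtain ⟨φ, h1, h2, h3⟩ := hg
  have hψ : ContDiff ℝ 1 fun y : ℝ => φ (-y) := (h1.comp contDiff_neg).of_le (by simp)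
  have hψc : HasCompactSupport fun y : ℝ => φ (-y) := h2.comp_homeomorph (Homeomorph.neg ℝ)
  have key := hψc.hasDerivAt_convolution_right (ContinuousLinearMap.mul ℝ ℝ)
    ((Lp.memLp f).locallyIntegrable (μ := volume) (by norm_num)) hψ h
  have e1 : (fun h => inner ℝ (translation h f) g) =
      convolution f (fun y : ℝ => φ (-y)) (ContinuousLinearMap.mul ℝ ℝ) volume := by
    ext k
    rw [inner_translation_test k f h3]
    simp [convolution]
  have e2 : inner ℝ (translation h f') g =
      convolution f (deriv fun y : ℝ => φ (-y)) (ContinuousLinearMap.mul ℝ ℝ) volume h := by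
    rw [inner_translation_test h f' h3]
    have := hf (fun x => φ (x - h)) (h1.comp (contDiff_id.sub contDiff_const))
      (hasCompactSupport_comp_sub h2 h)
    simp only [deriv_comp_sub_const] at this
    simp only [convolution, ContinuousLinearMap.mul_apply', deriv_comp_neg, mul_neg, neg_sub]
    rw [integral_neg, this, neg_neg]
  rw [e1, e2]
  exact key

theorem translation_zero (f : L2) : translation 0 f = f := by
  refine Lp.ext ?_
  simpa using coeFn_translation 0 f

/-- For test functions this is the mean value inequality, translation being isometric; both sides
are continuous in g, so density finishes. -/
theorem IsWeakDeriv.abs_inner_translation_sub_le {f f' : L2} (hf : IsWeakDeriv f f') (h : ℝ)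
    (g : L2) : |inner ℝ (translation h f - f) g| ≤ ‖f'‖ * |h| * ‖g‖ := by
  refine dense_testSubmodule.induction (P := fun g =>
    |inner ℝ (translation h f - f) g| ≤ ‖f'‖ * |h| * ‖g‖) (fun g hg => ?_)
    (isClosed_le (by fun_prop) (by fun_prop)) g
  have := Convex.norm_image_sub_le_of_norm_hasDerivWithin_le
    (f := fun h => inner ℝ (translation h f) g) (f' := fun h => inner ℝ (translation h f') g)
    (s := univ) (x := 0) (y := h) (C := ‖f'‖ * ‖g‖)
    (fun x _ => (hf.hasDerivAt_inner_translation hg x).hasDerivWithinAt)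
    (fun x _ => (norm_inner_le_norm _ _).trans (by rw [LinearIsometry.norm_map]))
    convex_univ (mem_univ _) (mem_univ _)
  rw [translation_zero, ← inner_sub_left, sub_zero, Real.norm_eq_abs, Real.norm_eq_abs] at this
  linarith

/-- Difference quotients converge weakly: they do so against test functions, and the previous bound
is uniform in h, so an ε/3 argument reaches every g. -/
theorem IsWeakDeriv.tendsto_inner_translation {f f' : L2} (hf : IsWeakDeriv f f') (g : L2) :
    Tendsto (fun h : ℝ => h⁻¹ * inner ℝ (translation h f - f) g) (𝓝[≠] 0)
      (𝓝 (inner ℝ f' g)) := by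
  rw [Metric.tendsto_nhds]
  intro ε hε
  set K := ‖f'‖ + 1
  have hK : 0 < K := by positivity
  obtain ⟨k, hk, hgk⟩ := dense_testSubmodule.exists_dist_lt g (ε := ε / (3 * K)) (by positivity)
  have hd := hf.hasDerivAt_inner_translation hk 0
  rw [translation_zero, hasDerivAt_iff_tendsto_slope] at hd
  have hev := Metric.tendsto_nhds.1 hd (ε / 3) (by positivity)
  filter_upwards [hev, self_mem_nhdsWithin] with h hh hne
  have hne : h ≠ 0 := hne
  rw [slope_def_field, translation_zero, ← inner_sub_left, sub_zero, Real.dist_eq, div_eq_inv_mul]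
    at hh
  have hgk' : K * ‖g - k‖ < ε / 3 := by
    rw [dist_eq_norm, lt_div_iff₀ (by positivity)] at hgk
    linarith
  have hn := norm_nonneg (g - k)
  have b1 : |h⁻¹ * inner ℝ (translation h f - f) (g - k)| ≤ K * ‖g - k‖ := by
    rw [abs_mul, abs_inv, inv_mul_le_iff₀ (by positivity)]
    refine (hf.abs_inner_translation_sub_le h (g - k)).trans ?_
    have : 0 ≤ |h| * ‖g - k‖ := by positivity
    simp only [K]
    linarith
  have b2 : |inner ℝ f' (g - k)| ≤ K * ‖g - k‖ := by
    refine (abs_real_inner_le_norm _ _).trans ?_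
    simp only [K]
    linarith
  rw [Real.dist_eq]
  have : h⁻¹ * inner ℝ (translation h f - f) g - inner ℝ f' g =
      h⁻¹ * inner ℝ (translation h f - f) (g - k)
      + (h⁻¹ * inner ℝ (translation h f - f) k - inner ℝ f' k) - inner ℝ f' (g - k) := by
    simp only [inner_sub_right]
    ring
  rw [this]
  rw [abs_lt] at hh ⊢
  rw [abs_le] at b1 b2
  constructor <;> linarith [hh.1, hh.2, b1.1, b1.2, b2.1, b2.2]

/-- The adjoint of translation by h is translation by -h. Passing to the limit in difference
quotients therefore gives integration by parts with no density of test functions in H¹. -/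
theorem IsWeakDeriv.inner_eq_neg {f f' g g' : L2} (hf : IsWeakDeriv f f') (hg : IsWeakDeriv g g') :
    inner ℝ f' g = - inner ℝ f g' := by
  have h1 := hf.tendsto_inner_translation g
  have h2 := hg.tendsto_inner_translation f
  have hneg : Tendsto (fun h : ℝ => -h) (𝓝[≠] 0) (𝓝[≠] 0) := by
    refine tendsto_nhdsWithin_iff.2 ⟨?_, ?_⟩
    · simpa using (continuous_neg.tendsto (0 : ℝ)).mono_left nhdsWithin_le_nhds
    · filter_upwards [self_mem_nhdsWithin] with x hx
      simpa using hx
  have h3 := (h2.comp hneg).neg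
  rw [real_inner_comm] at h3
  refine tendsto_nhds_unique h1 (h3.congr fun h => ?_)
  simp only [Function.comp, inner_sub_left, inner_translation_left (-h) g f, neg_neg]
  rw [real_inner_comm (translation h f) g, real_inner_comm f g, inv_neg]
  ring

/-- The classical derivative of a compactly supported `C¹` function is its weak derivative. -/
theorem IsWeakDeriv.test {φ : ℝ → ℝ} (h1 : ContDiff ℝ 1 φ) (h2 : HasCompactSupport φ) :
    IsWeakDeriv ((h1.continuous.memLp_of_hasCompactSupport h2).toLp φ)
      (((h1.continuous_deriv le_rfl).memLp_of_hasCompactSupport h2.deriv).toLp (deriv φ)) := by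
  intro ψ k1 k2
  have hφ := h1.continuous.memLp_of_hasCompactSupport (μ := volume) (p := 2) h2
  have hφ' := (h1.continuous_deriv le_rfl).memLp_of_hasCompactSupport (μ := volume) (p := 2)
    h2.deriv
  have hψ := k1.continuous.memLp_of_hasCompactSupport (μ := volume) (p := 2) k2
  have hψ' := (k1.continuous_deriv (by simp)).memLp_of_hasCompactSupport (μ := volume) (p := 2)
    k2.deriv
  have e1 : ∫ x, (hφ.toLp φ) x * deriv ψ x = ∫ x, φ x * deriv ψ x :=
    integral_congr_ae (by filter_upwards [hφ.coeFn_toLp] with x hx; rw [hx])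
  have e2 : ∫ x, (hφ'.toLp (deriv φ)) x * ψ x = ∫ x, deriv φ x * ψ x :=
    integral_congr_ae (by filter_upwards [hφ'.coeFn_toLp] with x hx; rw [hx])
  rw [e1, e2]
  exact integral_mul_deriv_eq_deriv_mul_of_integrable
    (fun x _ => (h1.differentiable one_ne_zero x).hasDerivAt)
    (fun x _ => (k1.differentiable (by simp) x).hasDerivAt)
    (hφ.integrable_mul hψ') (hφ'.integrable_mul hψ) (hφ.integrable_mul hψ)

/-- Test functions of class C¹ suffice; the product rule needs this, since the product of a C¹
coefficient and a smooth test function is only C¹. -/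
theorem IsWeakDeriv.integral_mul_deriv {f f' : L2} (hf : IsWeakDeriv f f') {φ : ℝ → ℝ}
    (h1 : ContDiff ℝ 1 φ) (h2 : HasCompactSupport φ) :
    ∫ x, f x * deriv φ x = - ∫ x, f' x * φ x := by
  have := hf.inner_eq_neg (IsWeakDeriv.test h1 h2)
  rw [inner_toLp, inner_toLp] at this
  rw [this, neg_neg]

/-! ### Multiplication operators and the product rule -/

theorem memLp_mul_of_isBC {g : ℝ → ℝ} (hg : IsBC g) (f : L2) :
    MemLp (fun x => g x * f x) 2 volume :=
  (Lp.memLp f).of_le_mul (c := hg.2.choose)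
    (hg.1.aestronglyMeasurable.mul (Lp.aestronglyMeasurable f))
    (.of_forall fun x => by
      rw [norm_mul]
      exact mul_le_mul_of_nonneg_right (hg.2.choose_spec x) (norm_nonneg _))

/-- Multiplication by a bounded continuous function on `L²(ℝ)`. -/
def mulL2 (g : ℝ → ℝ) (hg : IsBC g) : L2 →L[ℝ] L2 :=
  have hm := memLp_mul_of_isBC hg
  LinearMap.mkContinuous
    { toFun := fun f => (hm f).toLp _
      map_add' := fun a b => by
        refine Lp.ext ?_
        filter_upwards [(hm (a + b)).coeFn_toLp, (hm a).coeFn_toLp, (hm b).coeFn_toLp,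
          Lp.coeFn_add a b, Lp.coeFn_add ((hm a).toLp _) ((hm b).toLp _)] with x e1 e2 e3 e4 e5
        rw [e1, e5, Pi.add_apply, e2, e3, e4, Pi.add_apply, mul_add]
      map_smul' := fun c a => by
        refine Lp.ext ?_
        filter_upwards [(hm (c • a)).coeFn_toLp, (hm a).coeFn_toLp,
          Lp.coeFn_smul c a, Lp.coeFn_smul c ((hm a).toLp _)] with x e1 e2 e3 e4
        rw [RingHom.id_apply, e1, e4, Pi.smul_apply, e2, e3, Pi.smul_apply, smul_eq_mul,
          smul_eq_mul, mul_left_comm] }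
    hg.2.choose
    (fun f => Lp.norm_le_mul_norm_of_ae_le_mul (by
      filter_upwards [(hm f).coeFn_toLp] with x hx
      refine (le_of_eq (congrArg _ hx)).trans ?_
      rw [norm_mul]
      exact mul_le_mul_of_nonneg_right (hg.2.choose_spec x) (norm_nonneg _)))

theorem coeFn_mulL2 {g : ℝ → ℝ} (hg : IsBC g) (f : L2) :
    mulL2 g hg f =ᵐ[volume] fun x => g x * f x :=
  (memLp_mul_of_isBC hg f).coeFn_toLp

theorem inner_mulL2 {g : ℝ → ℝ} (hg : IsBC g) (f k : L2) :
    inner ℝ (mulL2 g hg f) k = ∫ x, g x * f x * k x := by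
  rw [real_inner_comm, inner_eq_integral_of_ae_eq k (coeFn_mulL2 hg f)]
  simp [mul_comm]

theorem inner_mulL2_comm {g : ℝ → ℝ} (hg : IsBC g) (f k : L2) :
    inner ℝ (mulL2 g hg f) k = inner ℝ f (mulL2 g hg k) := by
  rw [inner_mulL2, inner_eq_integral_of_ae_eq f (coeFn_mulL2 hg k)]
  exact integral_congr_ae (.of_forall fun x => by simp only; ring)

theorem integrable_mul_mul {g : ℝ → ℝ} (hg : IsBC g) (f k : L2) :
    Integrable fun x => g x * f x * k x := by
  refine ((Lp.memLp (mulL2 g hg f)).integrable_mul (Lp.memLp k)).congr ?_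
  filter_upwards [coeFn_mulL2 hg f] with x hx
  rw [Pi.mul_apply, hx]

theorem norm_mulL2_le {g : ℝ → ℝ} (hg : IsBC g) {c : ℝ} (hc : ∀ x, |g x| ≤ c) (f : L2) :
    ‖mulL2 g hg f‖ ≤ c * ‖f‖ := by
  refine Lp.norm_le_mul_norm_of_ae_le_mul ?_
  filter_upwards [coeFn_mulL2 hg f] with x hx
  rw [hx, norm_mul]
  exact mul_le_mul_of_nonneg_right (hc x) (norm_nonneg _)

theorem norm_mulL2_sq_le {g k : ℝ → ℝ} (hg : IsBC g) (hk : IsBC k) {c : ℝ}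
    (h : ∀ x, g x ^ 2 ≤ c * k x) (f : L2) :
    ‖mulL2 g hg f‖ ^ 2 ≤ c * inner ℝ (mulL2 k hk f) f := by
  rw [← real_inner_self_eq_norm_sq, inner_mulL2, inner_mulL2, ← integral_const_mul]
  refine integral_mono_ae (integrable_mul_mul hg _ _) ((integrable_mul_mul hk _ _).const_mul c) ?_
  filter_upwards [coeFn_mulL2 hg f] with x hx
  rw [hx]
  nlinarith [mul_le_mul_of_nonneg_right (h x) (sq_nonneg (f x))]

theorem inner_mulL2_self_nonneg {k : ℝ → ℝ} (hk : IsBC k) (h : ∀ x, 0 ≤ k x) (f : L2) :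
    0 ≤ inner ℝ (mulL2 k hk f) f := by
  rw [inner_mulL2]
  exact integral_nonneg fun x => by
    simp only [Pi.zero_apply, mul_assoc]
    exact mul_nonneg (h x) (mul_self_nonneg _)

theorem IsWeakDeriv.mulL2 {f f' : L2} (hf : IsWeakDeriv f f') {g : ℝ → ℝ} (h1 : Differentiable ℝ g)
    (hg : IsBC g) (hg' : IsBC (deriv g)) :
    IsWeakDeriv (mulL2 g hg f) (mulL2 (deriv g) hg' f + mulL2 g hg f') := by
  intro φ k1 k2
  have hC : ContDiff ℝ 1 g := contDiff_one_iff_deriv.2 ⟨h1, hg'.1⟩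
  have hφ1 : ContDiff ℝ 1 φ := k1.of_le (by simp)
  have key := hf.integral_mul_deriv (hC.mul hφ1) (k2.mul_left (f := g))
  have hd : ∀ x, deriv (fun x => g x * φ x) x = deriv g x * φ x + g x * deriv φ x := fun x =>
    deriv_fun_mul (h1 x) (hφ1.differentiable one_ne_zero x)
  have hφ := k1.continuous.memLp_of_hasCompactSupport (μ := volume) (p := 2) k2
  have hφ' := (k1.continuous_deriv (by simp)).memLp_of_hasCompactSupport (μ := volume) (p := 2)
    k2.deriv
  have i1 : ∫ x, (RotInertiaWave.mulL2 g hg f) x * deriv φ x = ∫ x, f x * (g x * deriv φ x) :=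
    integral_congr_ae (by filter_upwards [coeFn_mulL2 hg f] with x hx; rw [hx]; ring)
  have i2 : ∫ x, (RotInertiaWave.mulL2 g hg f') x * φ x = ∫ x, f' x * (g x * φ x) :=
    integral_congr_ae (by filter_upwards [coeFn_mulL2 hg f'] with x hx; rw [hx]; ring)
  have i3 : ∫ x, (RotInertiaWave.mulL2 (deriv g) hg' f) x * φ x = ∫ x, f x * (deriv g x * φ x) :=
    integral_congr_ae (by filter_upwards [coeFn_mulL2 hg' f] with x hx; rw [hx]; ring)
  rw [integral_add_mul_test _ _ k1.continuous k2, i1, i2, i3]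
  simp only [hd, mul_add] at key
  rw [integral_add] at key
  · linarith
  · refine ((Lp.memLp (RotInertiaWave.mulL2 (deriv g) hg' f)).integrable_mul hφ).congr ?_
    filter_upwards [coeFn_mulL2 hg' f] with x hx
    rw [Pi.mul_apply, hx]; ring
  · refine ((Lp.memLp (RotInertiaWave.mulL2 g hg f)).integrable_mul hφ').congr ?_
    filter_upwards [coeFn_mulL2 hg f] with x hx
    rw [Pi.mul_apply, hx]; ring

/-! ### H^k as a Hilbert space -/

theorem isWeakDeriv_iff_inner {f g : L2} : IsWeakDeriv f g ↔
    ∀ (φ : ℝ → ℝ) (h1 : ContDiff ℝ ∞ φ) (h2 : HasCompactSupport φ),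
      inner ℝ f (((h1.continuous_deriv (by simp)).memLp_of_hasCompactSupport h2.deriv).toLp (deriv φ))
        = - inner ℝ g ((h1.continuous.memLp_of_hasCompactSupport h2).toLp φ) := by
  simp only [inner_toLp]
  rfl

/-- Membership is a family of equalities between continuous inner products. The resulting
completeness is needed for the adjoint in `resolvent` and for the exponential of the generator. -/
theorem isClosed_H (k : ℕ) : IsClosed (H k : Set (PiLp 2 (fun _ : Fin (k + 1) => L2))) := by
  have : (H k : Set (PiLp 2 (fun _ : Fin (k + 1) => L2))) =
      {F | ∀ i : Fin k, IsWeakDeriv (F i.castSucc) (F i.succ)} := rfl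
  rw [this]
  simp only [isWeakDeriv_iff_inner, ofPred_forall]
  refine isClosed_iInter fun i => isClosed_iInter fun φ => isClosed_iInter fun h1 =>
    isClosed_iInter fun h2 => isClosed_eq ?_ ?_ <;> fun_prop

instance (k : ℕ) : CompleteSpace (H k) := (isClosed_H k).completeSpace_coe

/-- `D j` as a continuous linear map. -/
def DL {k : ℕ} (j : Fin (k + 1)) : H k →L[ℝ] L2 :=
  (PiLp.proj 2 (fun _ : Fin (k + 1) => L2) j : PiLp 2 (fun _ : Fin (k + 1) => L2) →L[ℝ] L2) ∘L
    (H k).subtypeL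

theorem DL_apply {k : ℕ} (j : Fin (k + 1)) (f : H k) : DL j f = D j f := rfl

theorem D_zero_right {k : ℕ} (j : Fin (k + 1)) : D j (0 : H k) = 0 := map_zero (DL j)

theorem D_sub {k : ℕ} (j : Fin (k + 1)) (f g : H k) : D j (f - g) = D j f - D j g :=
  map_sub (DL j) f g

theorem isWeakDeriv_D {k : ℕ} (i : Fin k) (f : H k) : IsWeakDeriv (D i.castSucc f) (D i.succ f) :=
  f.2 i

theorem H_ext {k : ℕ} {f g : H k} (h : ∀ j, D j f = D j g) : f = g :=
  Subtype.ext (PiLp.ext h)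

theorem H_ext_zero {k : ℕ} {f g : H k} (h : D 0 f = D 0 g) : f = g := by
  refine H_ext fun j => ?_
  induction j using Fin.induction with
  | zero => exact h
  | succ i ih => exact (isWeakDeriv_D i f).unique (ih ▸ isWeakDeriv_D i g)

theorem norm_sq_eq_sum_D {k : ℕ} (f : H k) : ‖f‖ ^ 2 = ∑ j, ‖D j f‖ ^ 2 :=
  PiLp.norm_sq_eq_of_L2 _ (f : PiLp 2 (fun _ : Fin (k + 1) => L2))

theorem inner_eq_sum_D {k : ℕ} (f g : H k) : inner ℝ f g = ∑ j, inner ℝ (D j f) (D j g) :=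
  PiLp.inner_apply (f : PiLp 2 (fun _ : Fin (k + 1) => L2)) g

section lift

variable {E : Type*} [NormedAddCommGroup E] [NormedSpace ℝ E]

/-- The map into `H^k(ℝ)` given by the maps for the derivatives. -/
def liftH {k : ℕ} (T : Fin (k + 1) → E →L[ℝ] L2)
    (hT : ∀ x (i : Fin k), IsWeakDeriv (T i.castSucc x) (T i.succ x)) : E →L[ℝ] H k :=
  (((PiLp.continuousLinearEquiv 2 ℝ (fun _ : Fin (k + 1) => L2)).symm :
    (Fin (k + 1) → L2) →L[ℝ] PiLp 2 (fun _ : Fin (k + 1) => L2)) ∘L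
      ContinuousLinearMap.pi T).codRestrict (H k) hT

end lift

/-! ### The resolvent of 1 - ∂ₓ² -/

/-- The weak solution map of `w - w'' = f`, with values in `H¹(ℝ)`. -/
def resolvent : L2 →L[ℝ] H 1 := ContinuousLinearMap.adjoint (DL (k := 1) 0)

/-- The adjoint of the inclusion of H¹ in L² is the Riesz solution operator, so the adjoint identity
is the weak form of w - w'' = f. -/
theorem inner_resolvent (f : L2) (g : H 1) :
    inner ℝ (D 0 (resolvent f)) (D 0 g) + inner ℝ (D 1 (resolvent f)) (D 1 g) =
      inner ℝ f (D 0 g) := by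
  have h := ContinuousLinearMap.adjoint_inner_left (DL (k := 1) 0) g f
  rw [DL_apply, inner_eq_sum_D, Fin.sum_univ_two] at h
  exact h

theorem isWeakDeriv_resolvent (f : L2) :
    IsWeakDeriv (D 1 (resolvent f)) (D 0 (resolvent f) - f) := by
  rw [isWeakDeriv_iff_inner]
  intro φ h1 h2
  let g : H 1 := ⟨WithLp.toLp 2 ![(h1.continuous.memLp_of_hasCompactSupport h2).toLp φ,
    ((h1.continuous_deriv (by simp)).memLp_of_hasCompactSupport h2.deriv).toLp (deriv φ)],
    fun i => by
      fin_cases i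
      exact IsWeakDeriv.test (h1.of_le (by simp)) h2⟩
  have h := inner_resolvent f g
  have e0 : D 0 g = (h1.continuous.memLp_of_hasCompactSupport h2).toLp φ := rfl
  have e1 : D 1 g = ((h1.continuous_deriv (by simp)).memLp_of_hasCompactSupport h2.deriv).toLp
    (deriv φ) := rfl
  rw [e0, e1] at h
  rw [inner_sub_left]
  linarith

/-- The inverse of `1 - ∂ₓ²`, from `H¹(ℝ)` to `H³(ℝ)`. -/
def resolventH : H 1 →L[ℝ] H 3 :=
  -- For w = `resolvent` f the derivatives are w, w', w'' = w - f and w''' = w' - f'; the last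
  -- exists because f is in H¹.
  liftH ![DL 0 ∘L resolvent ∘L DL 0, DL 1 ∘L resolvent ∘L DL 0,
      DL 0 ∘L resolvent ∘L DL 0 - DL 0, DL 1 ∘L resolvent ∘L DL 0 - DL 1] (by
    intro f i
    fin_cases i
    · exact isWeakDeriv_D 0 (resolvent (D 0 f))
    · exact isWeakDeriv_resolvent (D 0 f)
    · have := (isWeakDeriv_D 0 (resolvent (D 0 f))).add ((isWeakDeriv_D 0 f).smul (-1))
      rw [neg_one_smul, neg_one_smul, ← sub_eq_add_neg, ← sub_eq_add_neg] at this
      exact this)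

theorem D_zero_resolventH (f : H 1) : D 0 (resolventH f) - D 2 (resolventH f) = D 0 f :=
  sub_sub_cancel (D 0 (resolvent (D 0 f))) (D 0 f)

theorem D_one_resolventH (f : H 1) : D 1 (resolventH f) - D 3 (resolventH f) = D 1 f :=
  sub_sub_cancel (D 1 (resolvent (D 0 f))) (D 1 f)

/-- The inclusion of `H³(ℝ)` in `H²(ℝ)`. -/
def inclH : H 3 →L[ℝ] H 2 :=
  liftH (fun j => DL j.castSucc) fun f i => isWeakDeriv_D i.castSucc f

theorem D_inclH (j : Fin 3) (f : H 3) : D j (inclH f) = D j.castSucc f := rfl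

/-! ### The flow in H³ -/

theorem exists_linear_flow {E : Type*} [NormedAddCommGroup E] [NormedSpace ℝ E] [CompleteSpace E]
    (A : E →L[ℝ] E) (x : E) : ∃ U : ℝ → E, U 0 = x ∧ ∀ t, HasDerivAt U (A (U t)) t := by
  refine ⟨fun t => NormedSpace.exp (t • A) x, by simp, fun t => ?_⟩
  simpa using (hasDerivAt_exp_smul_const' A t).clm_apply (hasDerivAt_const t x)

section flow

variable {V : ℝ → ℝ} (hV : IsBC2 V)

/-- The map `(u, v) ↦ u'' - V u - v`, from `H³(ℝ) × H³(ℝ)` to `H¹(ℝ)`. -/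
def forcing : H 3 × H 3 →L[ℝ] H 1 :=
  liftH ![DL 2 ∘L ContinuousLinearMap.fst ℝ _ _
        - mulL2 V hV.2.2.1 ∘L DL 0 ∘L ContinuousLinearMap.fst ℝ _ _
        - DL 0 ∘L ContinuousLinearMap.snd ℝ _ _,
      DL 3 ∘L ContinuousLinearMap.fst ℝ _ _
        - (mulL2 (deriv V) hV.2.2.2.1 ∘L DL 0 + mulL2 V hV.2.2.1 ∘L DL 1)
            ∘L ContinuousLinearMap.fst ℝ _ _
        - DL 1 ∘L ContinuousLinearMap.snd ℝ _ _] (by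
    intro f i
    fin_cases i
    have h1 := isWeakDeriv_D 2 f.1
    have h2 := (isWeakDeriv_D 0 f.1).mulL2 hV.1 hV.2.2.1 hV.2.2.2.1
    have h3 := isWeakDeriv_D 0 f.2
    have := (h1.add (h2.smul (-1))).add (h3.smul (-1))
    simp only [neg_one_smul, ← sub_eq_add_neg] at this
    exact this)

/-- The generator of the first-order system for `(∫ u, u, uₜ)`. -/
def generator : H 3 × H 3 × H 3 →L[ℝ] H 3 × H 3 × H 3 :=
  (ContinuousLinearMap.fst ℝ _ _ ∘L ContinuousLinearMap.snd ℝ _ _).prod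
    ((ContinuousLinearMap.snd ℝ _ _ ∘L ContinuousLinearMap.snd ℝ _ _).prod
      (resolventH ∘L forcing hV ∘L ContinuousLinearMap.snd ℝ _ _))

/-- `u` solves the equation in `H³(ℝ)`, with time derivatives `v` and `a` and antiderivative `w`. -/
structure IsFlow (w u v a : ℝ → H 3) : Prop where
  deriv_w : ∀ t, HasDerivAt w (u t) t
  deriv_u : ∀ t, HasDerivAt u (v t) t
  deriv_v : ∀ t, HasDerivAt v (a t) t
  continuous_a : Continuous a
  equation : ∀ t, D 0 (a t) - D 2 (a t) = D 2 (u t) - mulL2 V hV.2.2.1 (D 0 (u t)) - D 0 (v t)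
  deriv_equation : ∀ t, D 1 (a t) - D 3 (a t) = D 3 (u t)
    - (mulL2 (deriv V) hV.2.2.2.1 (D 0 (u t)) + mulL2 V hV.2.2.1 (D 1 (u t))) - D 1 (v t)

theorem exists_isFlow (u₀ u₁ : H 3) : ∃ w u v a : ℝ → H 3, IsFlow hV w u v a ∧
    w 0 = 0 ∧ u 0 = u₀ ∧ v 0 = u₁ := by
  obtain ⟨U, hU0, hU⟩ := exists_linear_flow (generator hV) ((0 : H 3), u₀, u₁)
  have h2 : ∀ t, HasDerivAt (fun t => (U t).2) (generator hV (U t)).2 t := fun t =>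
    (ContinuousLinearMap.snd ℝ (H 3) (H 3 × H 3)).hasFDerivAt.comp_hasDerivAt t (hU t)
  have hc : Continuous U := continuous_iff_continuousAt.2 fun t => (hU t).continuousAt
  refine ⟨fun t => (U t).1, fun t => (U t).2.1, fun t => (U t).2.2,
    fun t => resolventH (forcing hV (U t).2), ⟨fun t => ?_, fun t => ?_, fun t => ?_, ?_, fun t => ?_,
      fun t => ?_⟩, by simp [hU0], by simp [hU0], by simp [hU0]⟩
  · exact hasFDerivAt_fst.comp_hasDerivAt t (hU t)
  · exact hasFDerivAt_fst.comp_hasDerivAt t (h2 t)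
  · exact hasFDerivAt_snd.comp_hasDerivAt t (h2 t)
  · fun_prop
  · exact D_zero_resolventH _
  · exact D_one_resolventH _

end flow

/-! ### Decay from differential inequalities -/

/-- Here A_j, B_j stand for the squared norms of ∂ₓʲu, ∂ₓʲu_t, P for ‖√V u‖², and E for the
functional of the time antiderivative. The rate e₁ is bounded twice: an error in A₀ is affordable in
the unweighted part, where E dissipates A₀, but in the part with weight 1+t it must be absorbed by
P, hence `he₁'`. -/
theorem decay_of_energy_inequalities
    {E₀ G₀ E₁ G₁ E₂ E e₀ g₀ e₁ g₁ e₂ e A₀ A₁ A₂ B₀ B₁ B₂ P : ℝ → ℝ} {m₀ m₁ m₂ δ N a b c f K : ℝ}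
    (hm₀ : 0 ≤ m₀) (hδ : 0 ≤ δ) (hδ1 : δ < 1)
    (hA₀ : ∀ t, 0 ≤ A₀ t) (hA₁ : ∀ t, 0 ≤ A₁ t) (hA₂ : ∀ t, 0 ≤ A₂ t)
    (hB₀ : ∀ t, 0 ≤ B₀ t) (hB₁ : ∀ t, 0 ≤ B₁ t) (hB₂ : ∀ t, 0 ≤ B₂ t) (hP : ∀ t, 0 ≤ P t)
    (dE₀ : ∀ t, HasDerivAt E₀ (e₀ t) t) (dG₀ : ∀ t, HasDerivAt G₀ (g₀ t) t)
    (dE₁ : ∀ t, HasDerivAt E₁ (e₁ t) t) (dG₁ : ∀ t, HasDerivAt G₁ (g₁ t) t)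
    (dE₂ : ∀ t, HasDerivAt E₂ (e₂ t) t) (dE : ∀ t, HasDerivAt E (e t) t)
    (he₀ : ∀ t, e₀ t ≤ -B₀ t) (hg₀ : ∀ t, g₀ t ≤ B₀ t + B₁ t - A₁ t - P t)
    (he₁ : ∀ t, e₁ t ≤ -(1 / 2) * B₁ t + 1 / 2 * (m₁ ^ 2 * A₀ t))
    (he₁' : ∀ t, e₁ t ≤ -(1 / 2) * B₁ t + 1 / 2 * (δ * P t))
    (hg₁ : ∀ t, g₁ t ≤ B₁ t + B₂ t - 1 / 2 * A₂ t + 1 / 2 * (m₀ ^ 2 * A₀ t))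
    (he₂ : ∀ t, e₂ t ≤ -(1 / 2) * B₂ t + m₂ ^ 2 * A₀ t + 4 * (m₁ ^ 2 * A₁ t))
    (he : ∀ t, e t ≤ -A₀ t)
    (hE₀ : ∀ t, E₀ t = 1 / 2 * (B₀ t + B₁ t + A₁ t + P t))
    (hG₀ : ∀ t, 1 / 4 * A₀ t - 2 * E₀ t ≤ G₀ t) (hG₀' : ∀ t, -E₀ t ≤ G₀ t)
    (hG₀'' : ∀ t, G₀ t ≤ E₀ t + A₀ t)
    (hE₁ : ∀ t, 0 ≤ E₁ t) (hG₁ : ∀ t, -E₁ t ≤ G₁ t)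
    (hE₁' : ∀ t, E₁ t ≤ 1 / 2 * (B₁ t + B₂ t + A₂ t + m₀ * A₁ t))
    (hE₂ : ∀ t, 0 ≤ E₂ t) (hE : ∀ t, -(1 / 2) * N ^ 2 ≤ E t)
    (hb : b = 1 + 24 * m₁ ^ 2) (hc : c = 2 * (3 + b)) (ha : a = b + 1)
    (hf : f = 1 + m₀ ^ 2 + 6 * m₂ ^ 2 + (3 + b) * m₁ ^ 2) (hK : K = 7 + 2 * m₀) {R : ℝ}
    (hR : (1 - δ) * E₀ 0 + (5 * E₀ 0 + (1 + δ) * G₀ 0 + 4 * E₁ 0)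
      + K * (f * E 0 + a * E₀ 0 + b * G₀ 0 + c * E₁ 0 + 6 * E₂ 0 + 2 * G₁ 0)
      + 1 / 2 * (K * f * N ^ 2) ≤ R) {t : ℝ} (ht : 0 ≤ t) :
    (1 - δ) * ((1 + t) ^ 2 * E₀ t) ≤ R ∧ 1 / 4 * ((1 + t) * A₀ t) ≤ R := by
  have hb0 : 1 ≤ b := by nlinarith [sq_nonneg m₁]
  have hf0 : 1 ≤ f := by
    have : 0 ≤ (3 + b) * m₁ ^ 2 := by positivity
    nlinarith [sq_nonneg m₀, sq_nonneg m₂]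
  have hE₀n : ∀ t, 0 ≤ E₀ t := fun t => by
    rw [hE₀]; linarith [hB₀ t, hB₁ t, hA₁ t, hP t]
  -- The derivative of (1+t)² is paid for by (1+t)Z', and that of 1+t by the K-multiple of the
  -- unweighted functional.
  let F : ℝ → ℝ := fun t => (1 - δ) * ((1 + t) ^ 2 * E₀ t)
    + (1 + t) * (5 * E₀ t + (1 + δ) * G₀ t + 4 * E₁ t)
    + K * (f * E t + a * E₀ t + b * G₀ t + c * E₁ t + 6 * E₂ t + 2 * G₁ t)
  let F' : ℝ → ℝ := fun t => (1 - δ) * (2 * (1 + t) * E₀ t + (1 + t) ^ 2 * e₀ t)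
    + ((5 * E₀ t + (1 + δ) * G₀ t + 4 * E₁ t)
      + (1 + t) * (5 * e₀ t + (1 + δ) * g₀ t + 4 * e₁ t))
    + K * (f * e t + a * e₀ t + b * g₀ t + c * e₁ t + 6 * e₂ t + 2 * g₁ t)
  have hF : ∀ t, HasDerivAt F (F' t) t := fun t => by
    have h1 : HasDerivAt (fun t : ℝ => 1 + t) 1 t := (hasDerivAt_id t).const_add 1
    have := (((h1.fun_pow 2).fun_mul (dE₀ t)).const_mul (1 - δ)).fun_add
      (h1.fun_mul ((((dE₀ t).const_mul 5).fun_add ((dG₀ t).const_mul (1 + δ))).fun_add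
        ((dE₁ t).const_mul 4)))
    have := this.fun_add (((((((dE t).const_mul f).fun_add ((dE₀ t).const_mul a)).fun_add
      ((dG₀ t).const_mul b)).fun_add ((dE₁ t).const_mul c)).fun_add
      ((dE₂ t).const_mul 6)).fun_add ((dG₁ t).const_mul 2) |>.const_mul K)
    refine this.congr_deriv ?_
    simp only [F']
    push_cast
    ring
  have hF'0 : ∀ t, 0 ≤ t → F' t ≤ 0 := fun t ht => by
    have z1 : 5 * e₀ t + (1 + δ) * g₀ t + 4 * e₁ t ≤ -((1 - δ) * (2 * E₀ t)) := by
      have := mul_le_mul_of_nonneg_left (hg₀ t) (by linarith : 0 ≤ 1 + δ)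
      rw [hE₀]
      nlinarith [he₀ t, he₁' t, mul_nonneg hδ (hA₁ t), hB₀ t]
    have z2 : 5 * E₀ t + (1 + δ) * G₀ t + 4 * E₁ t ≤
        K * (A₀ t + B₀ t + B₁ t + A₁ t + P t + B₂ t + A₂ t) := by
      have h1 : (1 + δ) * G₀ t ≤ 2 * (E₀ t + A₀ t) :=
        (mul_le_mul_of_nonneg_left (hG₀'' t) (by linarith)).trans
          (mul_le_mul_of_nonneg_right (by linarith) (add_nonneg (hE₀n t) (hA₀ t)))
      have h2 := hE₁' t
      have h3 := hE₀ t
      have h4 : 0 ≤ m₀ * (A₀ t + B₀ t + B₁ t + P t + B₂ t + A₂ t) := mul_nonneg hm₀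
        (by linarith [hA₀ t, hB₀ t, hB₁ t, hP t, hB₂ t, hA₂ t])
      rw [hK]
      nlinarith [hA₀ t, hA₁ t, hA₂ t, hB₀ t, hB₁ t, hB₂ t, hP t]
    -- The factor 6 in front of E₂ beats the 2B₂ from 2G₁; c beats (2+b)B₁ from G₀ and G₁; a beats
    -- bB₀; b beats the 24m₁²A₁ from 6E₂; f collects all errors in A₀. One unit of each quantity is
    -- left over.
    have z3 : f * e t + a * e₀ t + b * g₀ t + c * e₁ t + 6 * e₂ t + 2 * g₁ t ≤
        -(A₀ t + B₀ t + B₁ t + A₁ t + P t + B₂ t + A₂ t) := by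
      have h1 := mul_le_mul_of_nonneg_left (he t) (by linarith : 0 ≤ f)
      have h2 := mul_le_mul_of_nonneg_left (he₀ t) (by linarith : 0 ≤ a)
      have h3 := mul_le_mul_of_nonneg_left (hg₀ t) (by linarith : 0 ≤ b)
      have h4 := mul_le_mul_of_nonneg_left (he₁ t) (by linarith : 0 ≤ c)
      have h5 := mul_nonneg (by linarith : 0 ≤ b - 1) (hP t)
      have e1 : f * A₀ t = A₀ t + m₀ ^ 2 * A₀ t + 6 * (m₂ ^ 2 * A₀ t)
        + (3 + b) * (m₁ ^ 2 * A₀ t) := by rw [hf]; ring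
      have e2 : b * A₁ t = A₁ t + 24 * (m₁ ^ 2 * A₁ t) := by rw [hb]; ring
      have e3 : a * B₀ t = b * B₀ t + B₀ t := by rw [ha]; ring
      have e4 : c * (-(1 / 2) * B₁ t + 1 / 2 * (m₁ ^ 2 * A₀ t)) =
        -(3 * B₁ t) - b * B₁ t + (3 + b) * (m₁ ^ 2 * A₀ t) := by rw [hc]; ring
      have e5 : b * (B₀ t + B₁ t - A₁ t - P t) = b * B₀ t + b * B₁ t - b * A₁ t - b * P t := by ring
      linarith [he₂ t, hg₁ t]
    have z4 := mul_le_mul_of_nonneg_left z1 (by linarith : 0 ≤ 1 + t)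
    have z5 := mul_le_mul_of_nonneg_left z3 (by linarith : 0 ≤ K)
    have z6 : (1 - δ) * ((1 + t) ^ 2 * e₀ t) ≤ 0 :=
      mul_nonpos_of_nonneg_of_nonpos (by linarith)
        (mul_nonpos_of_nonneg_of_nonpos (by positivity) (by linarith [he₀ t, hB₀ t]))
    simp only [F']
    linarith
  have hanti : AntitoneOn F (Ici 0) := by
    refine antitoneOn_of_deriv_nonpos (convex_Ici 0)
      (fun t _ => (hF t).continuousAt.continuousWithinAt)
      (fun t _ => (hF t).differentiableAt.differentiableWithinAt) fun t ht => ?_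
    rw [interior_Ici] at ht
    rw [(hF t).deriv]
    exact hF'0 t (le_of_lt ht)
  have h0 := hanti (mem_Ici.2 le_rfl) (mem_Ici.2 ht) ht
  simp only [F] at h0
  -- This lower bound on the term of weight 1+t yields the decay of ‖u‖².
  have y1 : 1 / 4 * A₀ t ≤ 5 * E₀ t + (1 + δ) * G₀ t + 4 * E₁ t := by
    have := mul_le_mul_of_nonneg_left (hG₀ t) (by linarith : 0 ≤ 1 + δ)
    nlinarith [mul_nonneg hδ (hA₀ t), mul_nonneg (by linarith : 0 ≤ 1 - δ) (hE₀n t), hE₀n t, hE₁ t]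
  have y2 : -(1 / 2 * (f * N ^ 2)) ≤
      f * E t + a * E₀ t + b * G₀ t + c * E₁ t + 6 * E₂ t + 2 * G₁ t := by
    have h1 := mul_le_mul_of_nonneg_left (hE t) (by linarith : 0 ≤ f)
    have h2 := mul_le_mul_of_nonneg_left (hG₀' t) (by linarith : 0 ≤ b)
    have h3 := mul_nonneg (by linarith : 0 ≤ c - 2) (hE₁ t)
    have e1 : a * E₀ t = b * E₀ t + E₀ t := by rw [ha]; ring
    linarith [hG₁ t, hE₂ t, hE₀n t]
  have y3 := mul_le_mul_of_nonneg_left y1 (by linarith : 0 ≤ 1 + t)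
  have y4 := mul_le_mul_of_nonneg_left y2 (by linarith : 0 ≤ K)
  have y5 : 0 ≤ (1 - δ) * ((1 + t) ^ 2 * E₀ t) :=
    mul_nonneg (by linarith) (mul_nonneg (by positivity) (hE₀n t))
  have y6 : 0 ≤ (1 + t) * A₀ t := mul_nonneg (by linarith) (hA₀ t)
  constructor <;> linarith

/-! ### Energy identities in the space variable -/

section identities

theorem inner_D_succ {k : ℕ} (i j : Fin k) (f g : H k) :
    inner ℝ (D i.succ f) (D j.castSucc g) = - inner ℝ (D i.castSucc f) (D j.succ g) :=
  (isWeakDeriv_D i f).inner_eq_neg (isWeakDeriv_D j g)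

variable {V : ℝ → ℝ} (hV : IsBC2 V)

/-- Test with q. The source F is zero for u itself and for the difference of two solutions, and
equals u₀ + u₁ - u₁'' for the time antiderivative. -/
theorem inner_velocity_identity {k : ℕ} {p q a : H (k + 2)} {F : L2}
    (h : D 0 a - D 2 a = D 2 p - mulL2 V hV.2.2.1 (D 0 p) - D 0 q + F) :
    inner ℝ (D 0 q) (D 0 a) + inner ℝ (D 1 q) (D 1 a) + inner ℝ (D 1 p) (D 1 q)
      + inner ℝ (mulL2 V hV.2.2.1 (D 0 p)) (D 0 q) = - ‖D 0 q‖ ^ 2 + inner ℝ F (D 0 q) := by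
  have h1 := congrArg (fun x => inner ℝ x (D 0 q)) h
  simp only [inner_sub_left, inner_add_left, real_inner_self_eq_norm_sq] at h1
  have h2 : inner ℝ (D 2 a) (D 0 q) = - inner ℝ (D 1 a) (D 1 q) := inner_D_succ 1 0 a q
  have h3 : inner ℝ (D 2 p) (D 0 q) = - inner ℝ (D 1 p) (D 1 q) := inner_D_succ 1 0 p q
  rw [real_inner_comm (D 0 a), real_inner_comm (D 1 a)]
  linarith

end identities

section identities

variable {V : ℝ → ℝ} (hV : IsBC2 V)

theorem inner_displacement_identity {k : ℕ} {p q a : H (k + 2)}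
    (h : D 0 a - D 2 a = D 2 p - mulL2 V hV.2.2.1 (D 0 p) - D 0 q) :
    inner ℝ (D 0 a) (D 0 p) + inner ℝ (D 1 a) (D 1 p) + inner ℝ (D 0 q) (D 0 p) =
      - ‖D 1 p‖ ^ 2 - inner ℝ (mulL2 V hV.2.2.1 (D 0 p)) (D 0 p) := by
  have h1 := congrArg (fun x => inner ℝ x (D 0 p)) h
  simp only [inner_sub_left] at h1
  have h2 : inner ℝ (D 2 a) (D 0 p) = - inner ℝ (D 1 a) (D 1 p) := inner_D_succ 1 0 a p
  have h3 : inner ℝ (D 2 p) (D 0 p) = - inner ℝ (D 1 p) (D 1 p) := inner_D_succ 1 0 p p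
  rw [real_inner_self_eq_norm_sq] at h3
  linarith

theorem inner_displacement_deriv_identity {k : ℕ} {p q a : H (k + 2)}
    (h : D 0 a - D 2 a = D 2 p - mulL2 V hV.2.2.1 (D 0 p) - D 0 q) :
    inner ℝ (D 1 a) (D 1 p) + inner ℝ (D 2 a) (D 2 p) + inner ℝ (D 1 q) (D 1 p) =
      - ‖D 2 p‖ ^ 2 + inner ℝ (mulL2 V hV.2.2.1 (D 0 p)) (D 2 p) := by
  have h1 := congrArg (fun x => inner ℝ x (D 2 p)) h
  simp only [inner_sub_left, real_inner_self_eq_norm_sq] at h1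
  have h2 : inner ℝ (D 1 a) (D 1 p) = - inner ℝ (D 0 a) (D 2 p) := inner_D_succ 0 1 a p
  have h3 : inner ℝ (D 1 q) (D 1 p) = - inner ℝ (D 0 q) (D 2 p) := inner_D_succ 0 1 q p
  linarith

theorem inner_velocity_deriv_identity {p q a : H 3}
    (h : D 1 a - D 3 a = D 3 p
      - (mulL2 (deriv V) hV.2.2.2.1 (D 0 p) + mulL2 V hV.2.2.1 (D 1 p)) - D 1 q) :
    inner ℝ (D 1 q) (D 1 a) + inner ℝ (D 2 q) (D 2 a) + inner ℝ (D 2 p) (D 2 q)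
      + inner ℝ (mulL2 V hV.2.2.1 (D 1 p)) (D 1 q) =
      - ‖D 1 q‖ ^ 2 - inner ℝ (mulL2 (deriv V) hV.2.2.2.1 (D 0 p)) (D 1 q) := by
  have h1 := congrArg (fun x => inner ℝ x (D 1 q)) h
  simp only [inner_sub_left, inner_add_left, real_inner_self_eq_norm_sq] at h1
  have h2 : inner ℝ (D 3 a) (D 1 q) = - inner ℝ (D 2 a) (D 2 q) := inner_D_succ 2 1 a q
  have h3 : inner ℝ (D 3 p) (D 1 q) = - inner ℝ (D 2 p) (D 2 q) := inner_D_succ 2 1 p q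
  rw [real_inner_comm (D 1 a), real_inner_comm (D 2 a)]
  linarith

/-- The once differentiated equation is tested with q''', since a fourth derivative of a is not
available; the product rule then produces the commutator V'' p + 2V' p'. -/
theorem inner_velocity_deriv_deriv_identity {p q a : H 3}
    (h : D 1 a - D 3 a = D 3 p
      - (mulL2 (deriv V) hV.2.2.2.1 (D 0 p) + mulL2 V hV.2.2.1 (D 1 p)) - D 1 q) :
    inner ℝ (D 2 q) (D 2 a) + inner ℝ (D 3 q) (D 3 a) + inner ℝ (D 3 p) (D 3 q)
      + inner ℝ (mulL2 V hV.2.2.1 (D 2 p)) (D 2 q) =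
      - ‖D 2 q‖ ^ 2 - inner ℝ (mulL2 (deriv (deriv V)) hV.2.2.2.2 (D 0 p)
        + (2 : ℝ) • mulL2 (deriv V) hV.2.2.2.1 (D 1 p)) (D 2 q) := by
  have h1 := congrArg (fun x => inner ℝ x (D 3 q)) h
  have h2 : inner ℝ (D 2 a) (D 2 q) = - inner ℝ (D 1 a) (D 3 q) := inner_D_succ 1 2 a q
  have h3 : inner ℝ (D 2 q) (D 2 q) = - inner ℝ (D 1 q) (D 3 q) := inner_D_succ 1 2 q q
  have h4 := (((isWeakDeriv_D 0 p).mulL2 hV.2.1 hV.2.2.2.1 hV.2.2.2.2).add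
    ((isWeakDeriv_D 1 p).mulL2 hV.1 hV.2.2.1 hV.2.2.2.1)).inner_eq_neg (isWeakDeriv_D 2 q)
  change inner ℝ (mulL2 (deriv (deriv V)) hV.2.2.2.2 (D 0 p)
    + mulL2 (deriv V) hV.2.2.2.1 (D 1 p) + (mulL2 (deriv V) hV.2.2.2.1 (D 1 p)
    + mulL2 V hV.2.2.1 (D 2 p))) (D 2 q) = - inner ℝ (mulL2 (deriv V) hV.2.2.2.1 (D 0 p)
    + mulL2 V hV.2.2.1 (D 1 p)) (D 3 q) at h4
  simp only [inner_sub_left, inner_add_left, real_inner_smul_left] at h1 h4 ⊢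
  rw [real_inner_self_eq_norm_sq] at h3
  rw [real_inner_comm (D 2 a), real_inner_comm (D 3 a)]
  linarith

end identities

/-! ### Quadratic functionals and their time derivatives -/

section time

theorem hasDerivAt_D {k : ℕ} (j : Fin (k + 1)) {f : ℝ → H k} {f' : H k} {t : ℝ}
    (h : HasDerivAt f f' t) : HasDerivAt (fun t => D j (f t)) (D j f') t :=
  (DL j).hasFDerivAt.comp_hasDerivAt t h

theorem hasDerivAt_inner_mulL2 {g : ℝ → ℝ} (hg : IsBC g) {f : ℝ → L2} {f' : L2} {t : ℝ}
    (h : HasDerivAt f f' t) :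
    HasDerivAt (fun t => inner ℝ (mulL2 g hg (f t)) (f t)) (2 * inner ℝ (mulL2 g hg (f t)) f') t := by
  have h1 : HasDerivAt (fun t => mulL2 g hg (f t)) (mulL2 g hg f') t :=
    (mulL2 g hg).hasFDerivAt.comp_hasDerivAt t h
  refine (h1.inner ℝ h).congr_deriv ?_
  rw [inner_mulL2_comm hg f', real_inner_comm f']
  ring

/-- The quadratic form `½ (‖a‖² + ‖b‖² + ‖c‖² + ⟪g d, d⟫)`. -/
def quadEnergy (g : ℝ → ℝ) (hg : IsBC g) (a b c d : L2) : ℝ :=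
  1 / 2 * (‖a‖ ^ 2 + ‖b‖ ^ 2 + ‖c‖ ^ 2 + inner ℝ (mulL2 g hg d) d)

theorem hasDerivAt_quadEnergy {g : ℝ → ℝ} (hg : IsBC g) {a b c d : ℝ → L2} {a' b' c' d' : L2}
    {t : ℝ} (ha : HasDerivAt a a' t) (hb : HasDerivAt b b' t) (hc : HasDerivAt c c' t)
    (hd : HasDerivAt d d' t) :
    HasDerivAt (fun t => quadEnergy g hg (a t) (b t) (c t) (d t))
      (inner ℝ (a t) a' + inner ℝ (b t) b' + inner ℝ (c t) c'
        + inner ℝ (mulL2 g hg (d t)) d') t := by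
  refine ((((ha.norm_sq.fun_add hb.norm_sq).fun_add hc.norm_sq).fun_add
    (hasDerivAt_inner_mulL2 hg hd)).const_mul (1 / 2)).congr_deriv ?_
  ring

theorem quadEnergy_nonneg {g : ℝ → ℝ} (hg : IsBC g) (h : ∀ x, 0 ≤ g x) (a b c d : L2) :
    0 ≤ quadEnergy g hg a b c d := by
  have := inner_mulL2_self_nonneg hg h d
  unfold quadEnergy
  positivity

/-- The functional `⟪a', a⟫ + ⟪b', b⟫ + ½ ‖c‖²`. -/
def crossEnergy (a' a b' b c : L2) : ℝ := inner ℝ a' a + inner ℝ b' b + 1 / 2 * ‖c‖ ^ 2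

theorem hasDerivAt_crossEnergy {a b c a' b' : ℝ → L2} {a'' b'' c' : L2} {t : ℝ}
    (ha : HasDerivAt a (a' t) t) (ha' : HasDerivAt a' a'' t) (hb : HasDerivAt b (b' t) t)
    (hb' : HasDerivAt b' b'' t) (hc : HasDerivAt c c' t) :
    HasDerivAt (fun t => crossEnergy (a' t) (a t) (b' t) (b t) (c t))
      (‖a' t‖ ^ 2 + ‖b' t‖ ^ 2 + (inner ℝ a'' (a t) + inner ℝ b'' (b t) + inner ℝ c' (c t))) t := by
  refine (((ha'.inner ℝ ha).fun_add (hb'.inner ℝ hb)).fun_add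
    (hc.norm_sq.const_mul (1 / 2))).congr_deriv ?_
  rw [real_inner_self_eq_norm_sq, real_inner_self_eq_norm_sq, real_inner_comm c']
  ring

theorem abs_inner_le_half (x y : L2) : |inner ℝ x y| ≤ 1 / 2 * (‖x‖ ^ 2 + ‖y‖ ^ 2) := by
  have := abs_real_inner_le_norm x y
  nlinarith [sq_nonneg (‖x‖ - ‖y‖)]

end time

/-! ### Bounds by the data -/

theorem norm_D_sq_le {k : ℕ} (j : Fin (k + 1)) (f : H k) : ‖D j f‖ ^ 2 ≤ ‖f‖ ^ 2 := by
  rw [norm_sq_eq_sum_D]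
  exact Finset.single_le_sum (f := fun j => ‖D j f‖ ^ 2) (fun i _ => sq_nonneg _)
    (Finset.mem_univ j)

theorem inner_mulL2_self_le {g : ℝ → ℝ} (hg : IsBC g) {c : ℝ} (hc : ∀ x, |g x| ≤ c) (f : L2) :
    inner ℝ (mulL2 g hg f) f ≤ c * ‖f‖ ^ 2 := by
  refine (real_inner_le_norm _ _).trans ?_
  nlinarith [mul_le_mul_of_nonneg_right (norm_mulL2_le hg hc f) (norm_nonneg f)]

theorem norm_mulL2_sq_le_sq {g : ℝ → ℝ} (hg : IsBC g) {c : ℝ} (hc : ∀ x, |g x| ≤ c) (f : L2) :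
    ‖mulL2 g hg f‖ ^ 2 ≤ c ^ 2 * ‖f‖ ^ 2 := by
  rw [← mul_pow]
  exact pow_le_pow_left₀ (norm_nonneg _) (norm_mulL2_le hg hc f) 2

theorem quadEnergy_le {g : ℝ → ℝ} (hg : IsBC g) {m : ℝ} (hm : ∀ x, |g x| ≤ m) {I : ℝ}
    {a b c d : L2} (ha : ‖a‖ ^ 2 ≤ I) (hb : ‖b‖ ^ 2 ≤ I) (hc : ‖c‖ ^ 2 ≤ I) (hd : ‖d‖ ^ 2 ≤ I) :
    quadEnergy g hg a b c d ≤ (3 + m) * I := by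
  have hm0 : 0 ≤ m := (abs_nonneg _).trans (hm 0)
  have h1 := (inner_mulL2_self_le hg hm d).trans (mul_le_mul_of_nonneg_left hd hm0)
  have h2 : 0 ≤ I := (sq_nonneg _).trans ha
  have h3 : 0 ≤ m * I := mul_nonneg hm0 h2
  unfold quadEnergy
  nlinarith

theorem crossEnergy_le {I : ℝ} {a' a b' b c : L2} (ha' : ‖a'‖ ^ 2 ≤ I) (ha : ‖a‖ ^ 2 ≤ I)
    (hb' : ‖b'‖ ^ 2 ≤ I) (hb : ‖b‖ ^ 2 ≤ I) (hc : ‖c‖ ^ 2 ≤ I) :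
    crossEnergy a' a b' b c ≤ 3 * I := by
  have h1 := le_of_abs_le (abs_inner_le_half a' a)
  have h2 := le_of_abs_le (abs_inner_le_half b' b)
  have h3 : 0 ≤ I := (sq_nonneg _).trans ha
  unfold crossEnergy
  linarith

/-- The constant in the decay estimate, before division by `1 - α² ‖V‖`. -/
def decayConst (m₀ m₁ m₂ : ℝ) : ℝ :=
  (12 + (7 + 2 * m₀) * (2 * (1 + m₀ ^ 2 + 6 * m₂ ^ 2 + (3 + (1 + 24 * m₁ ^ 2)) * m₁ ^ 2)
    + (1 + 24 * m₁ ^ 2 + 1) + (1 + 24 * m₁ ^ 2) + 2 * (3 + (1 + 24 * m₁ ^ 2)) + 8)) * (3 + m₀)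

theorem decayConst_pos {m₀ m₁ m₂ : ℝ} (h : 0 ≤ m₀) : 0 < decayConst m₀ m₁ m₂ := by
  unfold decayConst
  positivity

/-! ### Decay along the flow -/

section flow

variable {V : ℝ → ℝ} (hV : IsBC2 V)

theorem isBC_sqrt {V : ℝ → ℝ} (hV : IsBC V) : IsBC fun x => √(V x) := by
  obtain ⟨h1, M, hM⟩ := hV
  refine ⟨h1.sqrt, √M, fun x => ?_⟩
  rw [abs_of_nonneg (Real.sqrt_nonneg _)]
  exact Real.sqrt_le_sqrt (le_of_abs_le (hM x))

variable {hV}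

/-- The equation integrated in time: the difference of the two sides has zero derivative, and w(0) =
0 identifies the constant. -/
theorem IsFlow.integrated_equation {w u v a : ℝ → H 3} (h : IsFlow hV w u v a) (hw : w 0 = 0)
    (t : ℝ) : D 0 (v t) - D 2 (v t) = D 2 (w t) - mulL2 V hV.2.2.1 (D 0 (w t)) - D 0 (u t)
      + (D 0 (u 0) + D 0 (v 0) - D 2 (v 0)) := by
  let Φ : ℝ → L2 := fun t => D 0 (v t) - D 2 (v t) - D 2 (w t)
    + mulL2 V hV.2.2.1 (D 0 (w t)) + D 0 (u t)
  have hΦ : ∀ t, HasDerivAt Φ 0 t := fun t => by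
    have hm : HasDerivAt (fun t => mulL2 V hV.2.2.1 (D 0 (w t))) (mulL2 V hV.2.2.1 (D 0 (u t))) t :=
      (mulL2 V hV.2.2.1).hasFDerivAt.comp_hasDerivAt t (hasDerivAt_D 0 (h.deriv_w t))
    refine (((((hasDerivAt_D 0 (h.deriv_v t)).fun_sub (hasDerivAt_D 2 (h.deriv_v t))).fun_sub
      (hasDerivAt_D 2 (h.deriv_w t))).fun_add hm).fun_add
      (hasDerivAt_D 0 (h.deriv_u t))).congr_deriv ?_
    rw [h.equation t]
    abel
  have hc := is_const_of_deriv_eq_zero (fun t => (hΦ t).differentiableAt)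
    (fun t => (hΦ t).deriv) t 0
  simp only [Φ, hw, D_zero_right, map_zero] at hc
  have hc' : D 0 (v t) - D 2 (v t) = (D 0 (v t) - D 2 (v t) - D 2 (w t)
      + mulL2 V hV.2.2.1 (D 0 (w t)) + D 0 (u t)) + D 2 (w t) - mulL2 V hV.2.2.1 (D 0 (w t))
      - D 0 (u t) := by abel
  rw [hc', hc]
  abel

theorem IsFlow.decay {w u v a : ℝ → H 3} (h : IsFlow hV w u v a) (hw : w 0 = 0)
    (hpos : ∀ x, 0 < V x) {α m₀ m₁ m₂ : ℝ} (hα : ∀ x, |deriv V x| ≤ α * V x)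
    (h0 : ∀ x, |V x| ≤ m₀) (h1 : ∀ x, |deriv V x| ≤ m₁) (h2 : ∀ x, |deriv (deriv V) x| ≤ m₂)
    (hsmall : α ^ 2 * m₀ < 1) {κ : L2}
    (hκ : D 0 (u 0) + D 0 (v 0) - D 2 (v 0) = mulL2 _ (isBC_sqrt hV.2.2.1) κ) {t : ℝ}
    (ht : 0 ≤ t) :
    (1 - α ^ 2 * m₀) * ((1 + t) ^ 2 * quadEnergy V hV.2.2.1 (D 0 (v t)) (D 1 (v t)) (D 1 (u t))
        (D 0 (u t))) ≤ decayConst m₀ m₁ m₂ * (‖u 0‖ ^ 2 + ‖v 0‖ ^ 2 + ‖κ‖ ^ 2) ∧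
      1 / 4 * ((1 + t) * ‖D 0 (u t)‖ ^ 2) ≤
        decayConst m₀ m₁ m₂ * (‖u 0‖ ^ 2 + ‖v 0‖ ^ 2 + ‖κ‖ ^ 2) := by
  have hm₀ : 0 ≤ m₀ := (abs_nonneg _).trans (h0 0)
  have hV0 : ∀ x, 0 ≤ V x := fun x => (hpos x).le
  set MV := mulL2 V hV.2.2.1 with hMV
  set MV' := mulL2 (deriv V) hV.2.2.2.1 with hMV'
  set MV'' := mulL2 (deriv (deriv V)) hV.2.2.2.2 with hMV''
  set F := mulL2 _ (isBC_sqrt hV.2.2.1) κ with hF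
  have dD := fun (j : Fin 4) t => hasDerivAt_D j (h.deriv_u t)
  have dD' := fun (j : Fin 4) t => hasDerivAt_D j (h.deriv_v t)
  have dDw := fun (j : Fin 4) t => hasDerivAt_D j (h.deriv_w t)
  have dE₀ : ∀ t, HasDerivAt (fun t => quadEnergy V hV.2.2.1 (D 0 (v t)) (D 1 (v t)) (D 1 (u t))
      (D 0 (u t))) (-‖D 0 (v t)‖ ^ 2) t := fun t => by
    refine (hasDerivAt_quadEnergy _ (dD' 0 t) (dD' 1 t) (dD 1 t) (dD 0 t)).congr_deriv ?_
    rw [inner_velocity_identity hV (F := 0) (by rw [h.equation t, add_zero]), inner_zero_left,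
      add_zero]
  have dG₀ : ∀ t, HasDerivAt (fun t => crossEnergy (D 0 (v t)) (D 0 (u t)) (D 1 (v t)) (D 1 (u t))
      (D 0 (u t))) (‖D 0 (v t)‖ ^ 2 + ‖D 1 (v t)‖ ^ 2 +
        (-‖D 1 (u t)‖ ^ 2 - inner ℝ (MV (D 0 (u t))) (D 0 (u t)))) t := fun t => by
    refine (hasDerivAt_crossEnergy (dD 0 t) (dD' 0 t) (dD 1 t) (dD' 1 t) (dD 0 t)).congr_deriv ?_
    rw [inner_displacement_identity hV (h.equation t)]
  have dE₁ : ∀ t, HasDerivAt (fun t => quadEnergy V hV.2.2.1 (D 1 (v t)) (D 2 (v t)) (D 2 (u t))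
      (D 1 (u t))) (-‖D 1 (v t)‖ ^ 2 - inner ℝ (MV' (D 0 (u t))) (D 1 (v t))) t := fun t => by
    refine (hasDerivAt_quadEnergy _ (dD' 1 t) (dD' 2 t) (dD 2 t) (dD 1 t)).congr_deriv ?_
    rw [inner_velocity_deriv_identity hV (h.deriv_equation t)]
  have dG₁ : ∀ t, HasDerivAt (fun t => crossEnergy (D 1 (v t)) (D 1 (u t)) (D 2 (v t)) (D 2 (u t))
      (D 1 (u t))) (‖D 1 (v t)‖ ^ 2 + ‖D 2 (v t)‖ ^ 2 +
        (-‖D 2 (u t)‖ ^ 2 + inner ℝ (MV (D 0 (u t))) (D 2 (u t)))) t := fun t => by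
    refine (hasDerivAt_crossEnergy (dD 1 t) (dD' 1 t) (dD 2 t) (dD' 2 t) (dD 1 t)).congr_deriv ?_
    rw [inner_displacement_deriv_identity hV (h.equation t)]
  have dE₂ : ∀ t, HasDerivAt (fun t => quadEnergy V hV.2.2.1 (D 2 (v t)) (D 3 (v t)) (D 3 (u t))
      (D 2 (u t))) (-‖D 2 (v t)‖ ^ 2
        - inner ℝ (MV'' (D 0 (u t)) + (2 : ℝ) • MV' (D 1 (u t))) (D 2 (v t))) t := fun t => by
    refine (hasDerivAt_quadEnergy _ (dD' 2 t) (dD' 3 t) (dD 3 t) (dD 2 t)).congr_deriv ?_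
    rw [inner_velocity_deriv_deriv_identity hV (h.deriv_equation t)]
  have dE : ∀ t, HasDerivAt (fun t => quadEnergy V hV.2.2.1 (D 0 (u t)) (D 1 (u t)) (D 1 (w t))
      (D 0 (w t)) - inner ℝ F (D 0 (w t))) (-‖D 0 (u t)‖ ^ 2) t := fun t => by
    refine ((hasDerivAt_quadEnergy _ (dD 0 t) (dD 1 t) (dDw 1 t) (dDw 0 t)).fun_sub
      ((hasDerivAt_const t F).inner ℝ (dDw 0 t))).congr_deriv ?_
    rw [inner_velocity_identity hV (F := F) (by rw [h.integrated_equation hw t, hκ]),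
      inner_zero_left]
    ring
  -- Pointwise |V'|² ≤ α²V² ≤ α²m₀V; this is where the smallness parameter δ = α²m₀ arises.
  have hMV'0 : ∀ f : L2, ‖MV' f‖ ^ 2 ≤ α ^ 2 * m₀ * inner ℝ (MV f) f := fun f => by
    refine norm_mulL2_sq_le _ _ (fun x => ?_) f
    have hx : |deriv V x| ^ 2 ≤ (α * V x) ^ 2 := pow_le_pow_left₀ (abs_nonneg _) (hα x) 2
    rw [sq_abs] at hx
    refine hx.trans ?_
    have : V x * V x ≤ m₀ * V x :=
      mul_le_mul_of_nonneg_right (le_of_abs_le (h0 x)) (hV0 x)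
    nlinarith [sq_nonneg α]
  set I := ‖u 0‖ ^ 2 + ‖v 0‖ ^ 2 + ‖κ‖ ^ 2 with hI
  have hu0 : ∀ j, ‖D j (u 0)‖ ^ 2 ≤ I := fun j => (norm_D_sq_le j (u 0)).trans
    (by simp only [hI]; nlinarith [sq_nonneg ‖v 0‖, sq_nonneg ‖κ‖])
  have hv0 : ∀ j, ‖D j (v 0)‖ ^ 2 ≤ I := fun j => (norm_D_sq_le j (v 0)).trans
    (by simp only [hI]; nlinarith [sq_nonneg ‖u 0‖, sq_nonneg ‖κ‖])
  have hI0 : 0 ≤ I := by positivity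
  refine decay_of_energy_inequalities (m₀ := m₀) (m₁ := m₁) (m₂ := m₂) (N := ‖κ‖)
    (A₀ := fun t => ‖D 0 (u t)‖ ^ 2) (A₁ := fun t => ‖D 1 (u t)‖ ^ 2)
    (A₂ := fun t => ‖D 2 (u t)‖ ^ 2) (B₀ := fun t => ‖D 0 (v t)‖ ^ 2)
    (B₁ := fun t => ‖D 1 (v t)‖ ^ 2) (B₂ := fun t => ‖D 2 (v t)‖ ^ 2)
    (P := fun t => inner ℝ (MV (D 0 (u t))) (D 0 (u t)))
    hm₀ (by positivity) hsmall (fun _ => sq_nonneg _) (fun _ => sq_nonneg _) (fun _ => sq_nonneg _)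
    (fun _ => sq_nonneg _) (fun _ => sq_nonneg _) (fun _ => sq_nonneg _)
    (fun _ => inner_mulL2_self_nonneg _ hV0 _) dE₀ dG₀ dE₁ dG₁ dE₂ dE
    (fun t => le_rfl) (fun t => by linarith) (fun t => ?_) (fun t => ?_) (fun t => ?_) (fun t => ?_)
    (fun t => le_rfl) (fun t => rfl) (fun t => ?_) (fun t => ?_) (fun t => ?_)
    (fun t => quadEnergy_nonneg _ hV0 _ _ _ _) (fun t => ?_) (fun t => ?_)
    (fun t => quadEnergy_nonneg _ hV0 _ _ _ _) (fun t => ?_) rfl rfl rfl rfl rfl ?_ ht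
  · have e1 := abs_le.1 (abs_inner_le_half (MV' (D 0 (u t))) (D 1 (v t)))
    have e2 := norm_mulL2_sq_le_sq hV.2.2.2.1 h1 (D 0 (u t))
    linarith [e1.1]
  · have e1 := abs_le.1 (abs_inner_le_half (MV' (D 0 (u t))) (D 1 (v t)))
    have e2 := hMV'0 (D 0 (u t))
    linarith [e1.1]
  · have e1 := abs_le.1 (abs_inner_le_half (MV (D 0 (u t))) (D 2 (u t)))
    have e2 := norm_mulL2_sq_le_sq hV.2.2.1 h0 (D 0 (u t))
    linarith [e1.2]
  · have e1 := abs_le.1 (abs_inner_le_half (MV'' (D 0 (u t)) + (2 : ℝ) • MV' (D 1 (u t)))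
      (D 2 (v t)))
    have e2 := norm_mulL2_sq_le_sq hV.2.2.2.2 h2 (D 0 (u t))
    have e3 := norm_mulL2_sq_le_sq hV.2.2.2.1 h1 (D 1 (u t))
    have e4 := norm_add_le (MV'' (D 0 (u t))) ((2 : ℝ) • MV' (D 1 (u t)))
    rw [norm_smul, Real.norm_eq_abs, abs_of_pos two_pos] at e4
    have e5 := pow_le_pow_left₀ (norm_nonneg _) e4 2
    nlinarith [e1.1, sq_nonneg (‖MV'' (D 0 (u t))‖ - 2 * ‖MV' (D 1 (u t))‖)]
  · have e1 := abs_le.1 (abs_inner_le_half (D 1 (v t)) (D 1 (u t)))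
    -- Doubling v before Young's inequality costs only ¼‖u‖² of the ½‖u‖² in the cross functional.
    have e2 := (abs_le.1 (abs_inner_le_half ((2 : ℝ) • D 0 (v t)) (D 0 (u t)))).1
    rw [real_inner_smul_left, norm_smul, Real.norm_eq_abs, abs_of_pos two_pos, mul_pow] at e2
    have e3 := inner_mulL2_self_nonneg hV.2.2.1 hV0 (D 0 (u t))
    unfold quadEnergy crossEnergy
    linarith [e1.1]
  · have e1 := abs_le.1 (abs_inner_le_half (D 1 (v t)) (D 1 (u t)))
    have e2 := abs_le.1 (abs_inner_le_half (D 0 (v t)) (D 0 (u t)))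
    have e3 := inner_mulL2_self_nonneg hV.2.2.1 hV0 (D 0 (u t))
    unfold quadEnergy crossEnergy
    linarith [e1.1, e2.1]
  · have e1 := abs_le.1 (abs_inner_le_half (D 1 (v t)) (D 1 (u t)))
    have e2 := abs_le.1 (abs_inner_le_half (D 0 (v t)) (D 0 (u t)))
    have e3 := inner_mulL2_self_nonneg hV.2.2.1 hV0 (D 0 (u t))
    unfold quadEnergy crossEnergy
    linarith [e1.2, e2.2]
  · have e1 := abs_le.1 (abs_inner_le_half (D 1 (v t)) (D 1 (u t)))
    have e2 := abs_le.1 (abs_inner_le_half (D 2 (v t)) (D 2 (u t)))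
    have e3 := inner_mulL2_self_nonneg hV.2.2.1 hV0 (D 1 (u t))
    unfold quadEnergy crossEnergy
    linarith [e1.1, e2.1]
  · have e3 := inner_mulL2_self_le hV.2.2.1 h0 (D 1 (u t))
    unfold quadEnergy
    linarith
  · have e1 := abs_le.1 (abs_inner_le_half κ (mulL2 _ (isBC_sqrt hV.2.2.1) (D 0 (w t))))
    have e2 := norm_mulL2_sq_le (isBC_sqrt hV.2.2.1) hV.2.2.1 (c := 1)
      (fun x => by rw [Real.sq_sqrt (hV0 x), one_mul]) (D 0 (w t))
    rw [← inner_mulL2_comm] at e1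
    unfold quadEnergy
    linarith [e1.2, sq_nonneg ‖D 0 (u t)‖, sq_nonneg ‖D 1 (u t)‖, sq_nonneg ‖D 1 (w t)‖]
  -- Each functional at time zero, and ‖κ‖², is at most Q. The terms of weights (1+t)² and 1+t
  -- contribute at most 1 + 5 + 2 + 4 = 12 multiples of Q.
  · set Q := (3 + m₀) * I with hQ
    have hQI : 3 * I ≤ Q := by simp only [hQ]; nlinarith [mul_nonneg hm₀ hI0]
    have q1 := quadEnergy_le hV.2.2.1 h0 (hv0 0) (hv0 1) (hu0 1) (hu0 0)
    have q2 := quadEnergy_le hV.2.2.1 h0 (hv0 1) (hv0 2) (hu0 2) (hu0 1)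
    have q3 := quadEnergy_le hV.2.2.1 h0 (hv0 2) (hv0 3) (hu0 3) (hu0 2)
    have q4 := (crossEnergy_le (hv0 0) (hu0 0) (hv0 1) (hu0 1) (hu0 0)).trans hQI
    have q5 := (crossEnergy_le (hv0 1) (hu0 1) (hv0 2) (hu0 2) (hu0 1)).trans hQI
    have q6 : quadEnergy V hV.2.2.1 (D 0 (u 0)) (D 1 (u 0)) (D 1 (w 0)) (D 0 (w 0))
        - inner ℝ F (D 0 (w 0)) ≤ Q := by
      have := quadEnergy_le hV.2.2.1 h0 (hu0 0) (hu0 1) (c := D 1 (w 0)) (d := D 0 (w 0))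
        (by simpa [hw, D_zero_right] using hI0) (by simpa [hw, D_zero_right] using hI0)
      simpa [hw, D_zero_right] using this
    have q7 : ‖κ‖ ^ 2 ≤ Q := by
      simp only [hI] at hQI hI0
      nlinarith [sq_nonneg ‖u 0‖, sq_nonneg ‖v 0‖]
    have hQ0 : 0 ≤ Q := by linarith
    have n1 := quadEnergy_nonneg hV.2.2.1 hV0 (D 0 (v 0)) (D 1 (v 0)) (D 1 (u 0)) (D 0 (u 0))
    rw [← hQ] at q1 q2 q3
    have hδ : 0 ≤ α ^ 2 * m₀ := by positivity
    have r1 : (1 - α ^ 2 * m₀) * quadEnergy V hV.2.2.1 (D 0 (v 0)) (D 1 (v 0)) (D 1 (u 0))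
        (D 0 (u 0)) ≤ Q := by nlinarith [mul_nonneg hδ n1]
    have r2 : (1 + α ^ 2 * m₀) * crossEnergy (D 0 (v 0)) (D 0 (u 0)) (D 1 (v 0)) (D 1 (u 0))
        (D 0 (u 0)) ≤ 2 * Q :=
      (mul_le_mul_of_nonneg_left q4 (by linarith)).trans
        (mul_le_mul_of_nonneg_right (by linarith) hQ0)
    have hR : decayConst m₀ m₁ m₂ * I = (12 + (7 + 2 * m₀) *
      (2 * (1 + m₀ ^ 2 + 6 * m₂ ^ 2 + (3 + (1 + 24 * m₁ ^ 2)) * m₁ ^ 2)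
      + (1 + 24 * m₁ ^ 2 + 1) + (1 + 24 * m₁ ^ 2) + 2 * (3 + (1 + 24 * m₁ ^ 2)) + 8)) * Q := by
      simp only [hQ, decayConst]; ring
    rw [hR]
    generalize hf : 1 + m₀ ^ 2 + 6 * m₂ ^ 2 + (3 + (1 + 24 * m₁ ^ 2)) * m₁ ^ 2 = f
    generalize hb : 1 + 24 * m₁ ^ 2 = b
    have hf0 : 0 ≤ f := by rw [← hf]; positivity
    have hb0 : 0 ≤ b := by rw [← hb]; positivity
    have s1 := mul_le_mul_of_nonneg_left q6 hf0
    have s2 := mul_le_mul_of_nonneg_left q1 (by linarith : 0 ≤ b + 1)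
    have s3 := mul_le_mul_of_nonneg_left q4 hb0
    have s4 := mul_le_mul_of_nonneg_left q2 (by linarith : 0 ≤ 2 * (3 + b))
    have s5 := mul_le_mul_of_nonneg_left q7 hf0
    have s6 := mul_nonneg hf0 (sq_nonneg ‖κ‖)
    have s7 := mul_le_mul_of_nonneg_left (add_le_add (add_le_add (add_le_add (add_le_add (add_le_add
      (add_le_add s1 s2) s3) s4) (mul_le_mul_of_nonneg_left q3 (by norm_num : (0 : ℝ) ≤ 6)))
      (mul_le_mul_of_nonneg_left q5 (by norm_num : (0 : ℝ) ≤ 2))) (by linarith :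
        1 / 2 * (f * ‖κ‖ ^ 2) ≤ f * Q)) (by linarith : 0 ≤ 7 + 2 * m₀)
    linarith

end flow

/-! ### Strong solutions: existence and uniqueness -/

theorem timeDeriv_eq {k : ℕ} {f : ℝ → H k} {f' : H k} {t : ℝ} (ht : 0 ≤ t)
    (h : HasDerivWithinAt f f' (Ici 0) t) : timeDeriv f t = f' :=
  h.derivWithin (uniqueDiffOn_Ici 0 t ht)

theorem equation_iff {V : ℝ → ℝ} (hV : IsBC V) {a₀ a₂ p₂ p₀ q₀ : L2} :
    (∀ᵐ x : ℝ, a₀ x - a₂ x - p₂ x + V x * p₀ x + q₀ x = 0) ↔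
      a₀ - a₂ = p₂ - mulL2 V hV p₀ - q₀ := by
  have h : (a₀ - a₂ - (p₂ - mulL2 V hV p₀ - q₀) : L2) =ᵐ[volume]
      fun x => a₀ x - a₂ x - p₂ x + V x * p₀ x + q₀ x := by
    filter_upwards [Lp.coeFn_sub (a₀ - a₂) (p₂ - mulL2 V hV p₀ - q₀), Lp.coeFn_sub a₀ a₂,
      Lp.coeFn_sub (p₂ - mulL2 V hV p₀) q₀, Lp.coeFn_sub p₂ (mulL2 V hV p₀),
      coeFn_mulL2 hV p₀] with x e1 e2 e3 e4 e5
    rw [e1, Pi.sub_apply, e2, e3, Pi.sub_apply, Pi.sub_apply, e4, Pi.sub_apply, e5]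
    ring
  rw [← sub_eq_zero, Lp.eq_zero_iff_ae_eq_zero]
  exact ⟨fun h' => h.trans h', fun h' => h.symm.trans h'⟩

section

variable {V : ℝ → ℝ} {hV : IsBC2 V}

theorem IsFlow.timeDeriv_incl {w u v a : ℝ → H 3} (h : IsFlow hV w u v a) {t : ℝ} (ht : 0 ≤ t) :
    timeDeriv (fun t => inclH (u t)) t = inclH (v t) :=
  timeDeriv_eq ht (inclH.hasFDerivAt.comp_hasDerivAt t (h.deriv_u t)).hasDerivWithinAt

theorem IsFlow.timeDeriv_timeDeriv_incl {w u v a : ℝ → H 3} (h : IsFlow hV w u v a) {t : ℝ}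
    (ht : 0 ≤ t) : timeDeriv (timeDeriv fun t => inclH (u t)) t = inclH (a t) :=
  timeDeriv_eq ht ((inclH.hasFDerivAt.comp_hasDerivAt t (h.deriv_v t)).hasDerivWithinAt.congr
    (fun _ hs => h.timeDeriv_incl hs) (h.timeDeriv_incl ht))

theorem IsFlow.contDiff {w u v a : ℝ → H 3} (h : IsFlow hV w u v a) : ContDiff ℝ 2 u := by
  have hu : deriv u = v := funext fun t => (h.deriv_u t).deriv
  have hv : deriv v = a := funext fun t => (h.deriv_v t).deriv
  have h1 : ContDiff ℝ 1 v := contDiff_one_iff_deriv.2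
    ⟨fun t => (h.deriv_v t).differentiableAt, hv ▸ h.continuous_a⟩
  exact (contDiff_succ_iff_deriv (n := 1)).2
    ⟨fun t => (h.deriv_u t).differentiableAt, by simp, hu ▸ h1⟩

theorem IsFlow.isStrongSolution {w u v a : ℝ → H 3} (h : IsFlow hV w u v a) :
    IsStrongSolution V (D 0 (u 0)) (D 0 (v 0)) fun t => inclH (u t) where
  contDiffOn := (inclH.contDiff.comp h.contDiff).contDiffOn
  equation t ht := by
    rw [h.timeDeriv_timeDeriv_incl ht.le, h.timeDeriv_incl ht.le]
    exact (equation_iff hV.2.2.1).2 (h.equation t)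
  initial := rfl
  initial_deriv := by rw [h.timeDeriv_incl le_rfl]; rfl

theorem IsStrongSolution.hasDerivWithinAt {f₀ f₁ : L2} {u : ℝ → H 2}
    (h : IsStrongSolution V f₀ f₁ u) {t : ℝ} (ht : 0 ≤ t) :
    HasDerivWithinAt u (timeDeriv u t) (Ici 0) t :=
  (h.contDiffOn.differentiableOn (by simp) t ht).hasDerivWithinAt

theorem IsStrongSolution.hasDerivWithinAt_timeDeriv {f₀ f₁ : L2} {u : ℝ → H 2}
    (h : IsStrongSolution V f₀ f₁ u) {t : ℝ} (ht : 0 ≤ t) :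
    HasDerivWithinAt (timeDeriv u) (timeDeriv (timeDeriv u) t) (Ici 0) t :=
  ((((contDiffOn_succ_iff_derivWithin (n := 1) (uniqueDiffOn_Ici 0)).1 h.contDiffOn).2.2
    ).differentiableOn (by simp) t ht).hasDerivWithinAt

/-- The energy of the difference is nonincreasing and starts at zero, so √V p = 0, and V > 0 gives p
= 0. Two weak derivatives suffice for this identity. -/
theorem IsStrongSolution.eqOn (hV : IsBC2 V) (hpos : ∀ x, 0 < V x) {f₀ f₁ : L2} {u v : ℝ → H 2}
    (hu : IsStrongSolution V f₀ f₁ u) (hv : IsStrongSolution V f₀ f₁ v) : EqOn v u (Ici 0) := by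
  have hV0 : ∀ x, 0 ≤ V x := fun x => (hpos x).le
  let p : ℝ → H 2 := fun t => v t - u t
  let q : ℝ → H 2 := fun t => timeDeriv v t - timeDeriv u t
  let a : ℝ → H 2 := fun t => timeDeriv (timeDeriv v) t - timeDeriv (timeDeriv u) t
  have hp : ∀ t, 0 ≤ t → HasDerivWithinAt p (q t) (Ici 0) t := fun t ht =>
    (hv.hasDerivWithinAt ht).sub (hu.hasDerivWithinAt ht)
  have hq : ∀ t, 0 ≤ t → HasDerivWithinAt q (a t) (Ici 0) t := fun t ht =>
    (hv.hasDerivWithinAt_timeDeriv ht).sub (hu.hasDerivWithinAt_timeDeriv ht)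
  have hp0 : p 0 = 0 := sub_eq_zero.2 (H_ext_zero (hv.initial.trans hu.initial.symm))
  have hq0 : q 0 = 0 := sub_eq_zero.2 (H_ext_zero (hv.initial_deriv.trans hu.initial_deriv.symm))
  have heq : ∀ t, 0 < t → D 0 (a t) - D 2 (a t) =
      D 2 (p t) - mulL2 V hV.2.2.1 (D 0 (p t)) - D 0 (q t) + 0 := fun t ht => by
    have h1 := (equation_iff hV.2.2.1).1 (hu.equation t ht)
    have h2 := (equation_iff hV.2.2.1).1 (hv.equation t ht)
    simp only [a, p, q, D_sub, map_sub]
    rw [sub_sub_sub_comm, h1, h2]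
    abel
  let e : ℝ → ℝ := fun t => quadEnergy V hV.2.2.1 (D 0 (q t)) (D 1 (q t)) (D 1 (p t)) (D 0 (p t))
  have he : ∀ t, 0 < t → HasDerivAt e (-‖D 0 (q t)‖ ^ 2) t := fun t ht => by
    have hpt := (hp t ht.le).hasDerivAt (Ici_mem_nhds ht)
    have hqt := (hq t ht.le).hasDerivAt (Ici_mem_nhds ht)
    refine (hasDerivAt_quadEnergy _ (hasDerivAt_D 0 hqt) (hasDerivAt_D 1 hqt)
      (hasDerivAt_D 1 hpt) (hasDerivAt_D 0 hpt)).congr_deriv ?_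
    rw [inner_velocity_identity hV (heq t ht), inner_zero_left, add_zero]
  have hcp : ∀ j, ContinuousOn (fun t => D j (p t)) (Ici 0) := fun j =>
    (DL j).continuous.comp_continuousOn fun t ht => (hp t ht).continuousWithinAt
  have hcq : ∀ j, ContinuousOn (fun t => D j (q t)) (Ici 0) := fun j =>
    (DL j).continuous.comp_continuousOn fun t ht => (hq t ht).continuousWithinAt
  -- The equation holds only for t > 0, so continuity has to carry monotonicity down to t = 0.
  have hce : ContinuousOn e (Ici 0) :=
    continuousOn_const.mul (((((hcq 0).norm.pow 2).add ((hcq 1).norm.pow 2)).add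
      ((hcp 1).norm.pow 2)).add
      (((mulL2 V hV.2.2.1).continuous.comp_continuousOn (hcp 0)).inner (𝕜 := ℝ) (hcp 0)))
  have hanti : AntitoneOn e (Ici 0) := by
    refine antitoneOn_of_deriv_nonpos (convex_Ici 0) hce (fun t ht => ?_) fun t ht => ?_ <;>
      rw [interior_Ici] at ht
    · exact (he t ht).differentiableAt.differentiableWithinAt
    · rw [(he t ht).deriv]
      exact neg_nonpos.2 (sq_nonneg _)
  have he0 : e 0 = 0 := by simp [e, hp0, hq0, D_zero_right, quadEnergy]
  intro t ht
  have h1 := hanti (mem_Ici.2 le_rfl) ht ht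
  rw [he0] at h1
  have h2 := norm_mulL2_sq_le (isBC_sqrt hV.2.2.1) hV.2.2.1 (c := 1)
    (fun x => by rw [Real.sq_sqrt (hV0 x), one_mul]) (D 0 (p t))
  have h3 : ‖mulL2 _ (isBC_sqrt hV.2.2.1) (D 0 (p t))‖ ^ 2 ≤ 0 := by
    simp only [e, quadEnergy] at h1
    linarith [sq_nonneg ‖D 0 (q t)‖, sq_nonneg ‖D 1 (q t)‖, sq_nonneg ‖D 1 (p t)‖]
  have h4 : mulL2 _ (isBC_sqrt hV.2.2.1) (D 0 (p t)) = 0 :=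
    norm_eq_zero.1 (pow_eq_zero_iff two_ne_zero |>.1 (le_antisymm h3 (sq_nonneg _)))
  have h5 : D 0 (p t) = 0 := by
    rw [Lp.eq_zero_iff_ae_eq_zero] at h4 ⊢
    filter_upwards [h4, coeFn_mulL2 (isBC_sqrt hV.2.2.1) (D 0 (p t))] with x hx hx'
    rw [hx'] at hx
    exact (mul_eq_zero.1 hx).resolve_left (Real.sqrt_pos.2 (hpos x)).ne'
  exact sub_eq_zero.1 (H_ext_zero (f := p t) (g := 0) (h5.trans (D_zero_right 0).symm))

theorem energy_incl_le (hpos : ∀ x, 0 < V x) {w u v a : ℝ → H 3} (h : IsFlow hV w u v a) {t : ℝ}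
    (ht : 0 ≤ t) : energy V (fun t => inclH (u t)) t ≤
      quadEnergy V hV.2.2.1 (D 0 (v t)) (D 1 (v t)) (D 1 (u t)) (D 0 (u t)) := by
  have h2 := norm_mulL2_sq_le (isBC_sqrt hV.2.2.1) hV.2.2.1 (c := 1)
    (fun x => by rw [Real.sq_sqrt (hpos x).le, one_mul]) (D 0 (u t))
  have h3 : ‖mulL2 _ (isBC_sqrt hV.2.2.1) (D 0 (u t))‖ =
      l2Norm fun x => √(V x) * D 0 (u t) x := by
    rw [Lp.norm_def, l2Norm, eLpNorm_congr_ae (coeFn_mulL2 (isBC_sqrt hV.2.2.1) (D 0 (u t)))]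
  rw [h3] at h2
  rw [energy, h.timeDeriv_incl ht, quadEnergy]
  simp only [D_inclH, Fin.castSucc_zero, Fin.castSucc_one]
  linarith

theorem weightedData_toLp (hpos : ∀ x, 0 < V x) {u₀ u₁ : H 3}
    (hm : MemLp (weightedData V u₀ u₁) 2 volume) :
    D 0 u₀ + D 0 u₁ - D 2 u₁ = mulL2 _ (isBC_sqrt hV.2.2.1) (hm.toLp _) := by
  refine Lp.ext ?_
  filter_upwards [Lp.coeFn_sub (D 0 u₀ + D 0 u₁) (D 2 u₁), Lp.coeFn_add (D 0 u₀) (D 0 u₁),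
    coeFn_mulL2 (isBC_sqrt hV.2.2.1) (hm.toLp _), hm.coeFn_toLp] with x e1 e2 e3 e4
  rw [e1, Pi.sub_apply, e2, e3, e4, Pi.add_apply, weightedData,
    mul_div_cancel₀ _ (Real.sqrt_pos.2 (hpos x)).ne']

end

theorem IsBC.abs_le_supNorm {g : ℝ → ℝ} (hg : IsBC g) (x : ℝ) : |g x| ≤ supNorm g :=
  le_ciSup (f := fun x => |g x|) ⟨hg.2.choose, by rintro _ ⟨y, rfl⟩; exact hg.2.choose_spec y⟩ x

end RotInertiaWave
end

/-! ### The decay theorem -/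

theorem theorem1p1 :
    ∃ C : ℝ → ℝ → ℝ → ℝ → ℝ, (∀ a m₀ m₁ m₂ : ℝ, 0 < C a m₀ m₁ m₂) ∧
      ∀ (V : ℝ → ℝ) (α : ℝ), IsBC2 V → (∀ x, 0 < V x) → 0 < α →
        (∀ x, |deriv V x| ≤ α * V x) → α ^ 2 * supNorm V < 1 →
      ∀ u₀ u₁ : H 3, MemLp (weightedData V u₀ u₁) 2 volume →
        ∃ u : ℝ → H 2, IsStrongSolution V (D 0 u₀) (D 0 u₁) u ∧
          (∀ v : ℝ → H 2, IsStrongSolution V (D 0 u₀) (D 0 u₁) v → EqOn v u (Ici 0)) ∧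
          ∀ t : ℝ, 0 ≤ t →
            energy V u t ≤
              C α (supNorm V) (supNorm (deriv V)) (supNorm (deriv (deriv V)))
                * dataSize V u₀ u₁ * (1 + t) ^ (-2 : ℤ) ∧
            ‖D 0 (u t)‖ ^ 2 ≤
              C α (supNorm V) (supNorm (deriv V)) (supNorm (deriv (deriv V)))
                * dataSize V u₀ u₁ * (1 + t) ^ (-1 : ℤ) := by
  classical
  -- The two summands serve the two estimates. The value 1 outside the admissible range only makes
  -- the constant positive for all arguments.
  refine ⟨fun a m₀ m₁ m₂ => if 0 ≤ m₀ ∧ a ^ 2 * m₀ < 1 then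
    decayConst m₀ m₁ m₂ / (1 - a ^ 2 * m₀) + 4 * decayConst m₀ m₁ m₂ else 1, fun a m₀ m₁ m₂ => ?_,
    fun V α hV hpos _ hVα hsmall u₀ u₁ hm => ?_⟩
  · beta_reduce
    split_ifs with h
    · have := decayConst_pos (m₁ := m₁) (m₂ := m₂) h.1
      have : 0 < 1 - a ^ 2 * m₀ := by linarith [h.2]
      positivity
    · exact one_pos
  have hm₀ : 0 ≤ supNorm V := (abs_nonneg _).trans (hV.2.2.1.abs_le_supNorm 0)
  obtain ⟨w, u, v, a, h, hw, rfl, rfl⟩ := exists_isFlow hV u₀ u₁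
  refine ⟨fun t => inclH (u t), h.isStrongSolution,
    fun z hz => h.isStrongSolution.eqOn hV hpos hz, fun t ht => ?_⟩
  beta_reduce
  rw [if_pos ⟨hm₀, hsmall⟩]
  obtain ⟨b1, b2⟩ := h.decay hw hpos hVα hV.2.2.1.abs_le_supNorm hV.2.2.2.1.abs_le_supNorm
    hV.2.2.2.2.abs_le_supNorm hsmall (weightedData_toLp (hV := hV) hpos hm) ht
  have hI : ‖u 0‖ ^ 2 + ‖v 0‖ ^ 2 + ‖hm.toLp _‖ ^ 2 = dataSize V (u 0) (v 0) := by
    rw [Lp.norm_toLp]; rfl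
  rw [hI] at b1 b2
  have hI0 : 0 ≤ dataSize V (u 0) (v 0) := by rw [← hI]; positivity
  have hc := decayConst_pos (m₁ := supNorm (deriv V)) (m₂ := supNorm (deriv (deriv V))) hm₀
  set c := decayConst (supNorm V) (supNorm (deriv V)) (supNorm (deriv (deriv V)))
  have hδ : 0 < 1 - α ^ 2 * supNorm V := by linarith
  have hτ : 0 < 1 + t := by linarith
  rw [zpow_neg, zpow_neg, zpow_one, show (1 + t) ^ (2 : ℤ) = (1 + t) ^ 2 from by norm_cast,
    ← div_eq_mul_inv, ← div_eq_mul_inv, le_div_iff₀ (by positivity), le_div_iff₀ hτ, add_mul]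
  have hn1 : 0 ≤ c / (1 - α ^ 2 * supNorm V) * dataSize V (u 0) (v 0) := by positivity
  have hn2 : 0 ≤ 4 * c * dataSize V (u 0) (v 0) := by positivity
  constructor
  · have e1 := mul_le_mul_of_nonneg_right (energy_incl_le hpos h ht) (sq_nonneg (1 + t))
    have e2 : (1 + t) ^ 2 * quadEnergy V hV.2.2.1 (D 0 (v t)) (D 1 (v t)) (D 1 (u t)) (D 0 (u t))
        ≤ c / (1 - α ^ 2 * supNorm V) * dataSize V (u 0) (v 0) := by
      rw [div_mul_eq_mul_div, le_div_iff₀ hδ]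
      linarith
    linarith
  · have e : D 0 (inclH (u t)) = D 0 (u t) := rfl
    rw [e]
    linarith
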